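/- Let $W$ be a finite nonempty set. All $C^*$-algebras are unital, $\otimes$ is the minimal tensor product, and a magic unitary over $W$ is a unitary matrix $[u_{i,j}]_{i,j\in W}$ whose entries are projections. Let $C(S_W^+)$ be the universal $C^*$-algebra generated by the entries of a magic unitary over $W$. A quantum permutation group acting on $W$ is a compact quantum group $\mathbb G=(C(\mathbb G),\Delta)$, with $C(\mathbb G)\neq 0$, together with a surjective unital $*$-homomorphism $\pi:C(S_W^+)\to C(\mathbb G)$ such that the images $u_{i,j}$ of the canonical generators satisfy $\Delta(u_{i,j})=\sum_{k\in W}u_{i,k}\otimes u_{k,j}$ for all $i,j\in W$. Its quantum orbitals are the classes of the relation on $W\times W$ given by $(i,i')\sim(j,j')$ if and only if $u_{i,j}u_{i',j'}\neq 0$. A game $\mathscr G=(W,V)$ is a function $V(a,b|x,y)\in\{0,1\}$ of $a,b,x,y\in W$. It is bisynchronous if $V(a,b|x,x)=0$ for all $x$ and all $a\ne b$, and $V(a,a|x,y)=0$ for all $a$ and all $x\neq y$. It is transitive if $V(a,b|r,s)=V(r,s|x,y)=1$ for some $r,s\in W$ implies $V(a,b|x,y)=1$. Let $C^*(\mathscr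 G)$ be the universal $C^*$-algebra generated by projections $v_{x,a}$ $(x,a\in W)$ with $\sum_{a\in W} v_{x,a}=1$ for all $x\in W$, and $v_{x,a}v_{y,b}=0$ whenever $V(a,b|x,y)=0$. The game has a perfect $C^*$-strategy if $C^*(\mathscr G)\neq 0$. Theorem. Let $\mathbb G$ be a quantum permutation group acting on a finite nonempty set $W$, with canonical generators $u_{x,a}$. Define the game $\mathscr G=(W,V)$ by $V(a,b|x,y)=0$ if and only if $u_{x,a}u_{y,b}=0$. Then $\mathscr G$ is bisynchronous and transitive and has a perfect $C^*$-strategy. There is a comultiplication $\Delta$ on $C^*(\mathscr G)$ with $\Delta(v_{x,a})=\sum_{r\in W}v_{x,r}\otimes v_{r,a}$ for all $x,a\in W$, for which $(C^*(\mathscr G),\Delta)$ is a quantum permutation group acting on $W$ with canonical generators $v_{x,a}$. The quantum orbitals of $\mathbb G$ form a partition of $W\times W$, and the quantum orbitals of $(C^*(\mathscr G),\Delta)$ are the same as the quantum orbitals of $\mathbb G$. -/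

import Mathlib

open scoped TensorProduct InnerProductSpace
open UniformSpace (Completion)

universe u

noncomputable section

namespace QPG

/-- A representation of a unital complex *-algebra `P`: a unital *-homomorphism into the bounded
operators on a complex Hilbert space. -/
structure HilbRep (P : Type u) [Ring P] [StarRing P] [Algebra ℂ P] : Type (u + 1) where
  /-- the Hilbert space -/
  space : Type u
  [normed : NormedAddCommGroup space]
  [inner : InnerProductSpace ℂ space]
  [complete : CompleteSpace space]
  hom : P →⋆ₐ[ℂ] (space →L[ℂ] space)

attribute [instance] HilbRep.normed HilbRep.inner HilbRep.complete

section Completion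
variable {E : Type u} [NormedAddCommGroup E] [InnerProductSpace ℂ E]

theorem clm_compl_ext {S T : Completion E →L[ℂ] Completion E}
    (h : ∀ x : E, S (x : Completion E) = T (x : Completion E)) : S = T :=
  ContinuousLinearMap.ext fun c =>
    Completion.induction_on c (isClosed_eq S.continuous T.continuous) h

/-- The extension of bounded operators on an inner product space to its completion. -/
def complHom (E : Type u) [NormedAddCommGroup E] [InnerProductSpace ℂ E] :
    (E →L[ℂ] E) →ₐ[ℂ] (Completion E →L[ℂ] Completion E) :=
  AlgHom.ofLinearMap
    { toFun := fun T => T.completion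
      map_add' := fun S T => clm_compl_ext fun x => by
        simp [Completion.coe_add]
      map_smul' := fun r T => clm_compl_ext fun x => by
        simp [Completion.coe_smul] }
    (clm_compl_ext fun x => by
      rw [LinearMap.coe_mk, AddHom.coe_mk, ContinuousLinearMap.completion_apply_coe]; rfl)
    (fun S T => clm_compl_ext fun x => by
      simp only [LinearMap.coe_mk, AddHom.coe_mk, mul_apply_eq_comp,
        ContinuousLinearMap.completion_apply_coe])

theorem complHom_coe (T : E →L[ℂ] E) (x : E) :
    complHom E T (x : Completion E) = ((T x : E) : Completion E) := by
  simp [complHom]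

end Completion

namespace HilbRep

variable {P Q : Type u} [Ring P] [StarRing P] [Algebra ℂ P] [Ring Q] [StarRing Q] [Algebra ℂ Q]

/-- The representation `a ⊗ b ↦ π a ⊗ ρ b` of `P ⊗ Q` on the algebraic tensor product of the two
Hilbert spaces (with its Hilbertian inner product). -/
def algTensorHom (π : HilbRep P) (ρ : HilbRep Q) :
    P ⊗[ℂ] Q →ₐ[ℂ] (π.space ⊗[ℂ] ρ.space →L[ℂ] π.space ⊗[ℂ] ρ.space) :=
  Algebra.TensorProduct.algHomOfLinearMapTensorProduct
    (TensorProduct.lift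
      (LinearMap.mk₂ ℂ (fun a b => TensorProduct.mapL (π.hom a) (ρ.hom b))
        (fun a a' b => by rw [map_add, TensorProduct.mapL_add_left])
        (fun c a b => by rw [map_smul, TensorProduct.mapL_smul_left])
        (fun a b b' => by rw [map_add, TensorProduct.mapL_add_right])
        (fun c a b => by rw [map_smul, TensorProduct.mapL_smul_right])))
    (fun a a' b b' => by
      simp only [TensorProduct.lift.tmul, LinearMap.mk₂_apply, map_mul]
      exact TensorProduct.mapL_mul _ _ _ _)
    (by
      simp only [TensorProduct.lift.tmul, LinearMap.mk₂_apply, map_one]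
      exact TensorProduct.mapL_id_id)

theorem algTensorHom_tmul (π : HilbRep P) (ρ : HilbRep Q) (a : P) (b : Q) :
    algTensorHom π ρ (a ⊗ₜ b) = TensorProduct.mapL (π.hom a) (ρ.hom b) := by
  simp [algTensorHom]

variable [StarModule ℂ P] [StarModule ℂ Q]

theorem algTensorHom_adjoint (π : HilbRep P) (ρ : HilbRep Q) (x : P ⊗[ℂ] Q)
    (ξ η : π.space ⊗[ℂ] ρ.space) :
    ⟪algTensorHom π ρ (star x) ξ, η⟫_ℂ = ⟪ξ, algTensorHom π ρ x η⟫_ℂ := by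
  induction x with
  | zero => simp
  | add x y hx hy => simp [inner_add_left, inner_add_right, hx, hy]
  | tmul a b =>
    rw [TensorProduct.star_tmul, algTensorHom_tmul, algTensorHom_tmul]
    induction ξ with
    | zero => simp
    | add x y hx hy => simp only [map_add, inner_add_left, hx, hy]
    | tmul ξ₁ ξ₂ =>
      induction η with
      | zero => simp
      | add x y hx hy => simp only [map_add, inner_add_right, hx, hy]
      | tmul η₁ η₂ =>
        simp [map_star, ContinuousLinearMap.star_eq_adjoint,
          ContinuousLinearMap.adjoint_inner_left]

/-- The tensor product of two representations, on the Hilbert space tensor product (the completion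
of the algebraic one). -/
def tensor (π : HilbRep P) (ρ : HilbRep Q) : HilbRep (P ⊗[ℂ] Q) where
  space := Completion (π.space ⊗[ℂ] ρ.space)
  hom :=
    { (complHom (π.space ⊗[ℂ] ρ.space)).comp (algTensorHom π ρ) with
      map_star' := fun x => by
        change complHom _ (algTensorHom π ρ (star x)) = star (complHom _ (algTensorHom π ρ x))
        rw [ContinuousLinearMap.star_eq_adjoint, ContinuousLinearMap.eq_adjoint_iff]
        intro ξ η
        induction ξ, η using Completion.induction_on₂ with
        | hp => apply isClosed_eq <;> fun_prop
        | ih ξ η => simp only [complHom_coe, Completion.inner_coe, algTensorHom_adjoint] }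

theorem tensor_hom_tmul (π : HilbRep P) (ρ : HilbRep Q) (a : P) (b : Q)
    (ξ : π.space) (η : ρ.space) :
    (tensor π ρ).hom (a ⊗ₜ b) ((ξ ⊗ₜ[ℂ] η : π.space ⊗[ℂ] ρ.space) : Completion _) =
      ((π.hom a ξ ⊗ₜ[ℂ] ρ.hom b η : π.space ⊗[ℂ] ρ.space) : Completion _) := by
  change complHom _ (algTensorHom π ρ (a ⊗ₜ b)) _ = _
  rw [complHom_coe, algTensorHom_tmul, TensorProduct.mapL_tmul]

end HilbRep

/-- A family of representations of a *-algebra that is bounded on every element. -/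
structure RepFamily (P : Type u) [Ring P] [StarRing P] [Algebra ℂ P] : Type (u + 1) where
  carrier : Set (HilbRep P)
  bdd : ∀ x : P, BddAbove (Set.range fun π : carrier => ‖π.1.hom x‖)

namespace RepFamily

variable {P : Type u} [Ring P] [StarRing P] [Algebra ℂ P]

/-- The C*-seminorm `x ↦ sup ‖π x‖`, the supremum over all representations of the family. -/
def seminorm (F : RepFamily P) (x : P) : ℝ := ⨆ π : F.carrier, ‖π.1.hom x‖

variable (F : RepFamily P)

theorem le_seminorm (π : HilbRep P) (h : π ∈ F.carrier) (x : P) : ‖π.hom x‖ ≤ F.seminorm x :=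
  le_ciSup (F.bdd x) (⟨π, h⟩ : F.carrier)

theorem seminorm_nonneg (x : P) : 0 ≤ F.seminorm x :=
  Real.iSup_nonneg fun _ => norm_nonneg _

theorem seminorm_le {x : P} {C : ℝ} (hC : 0 ≤ C) (h : ∀ π ∈ F.carrier, ‖π.hom x‖ ≤ C) :
    F.seminorm x ≤ C :=
  Real.iSup_le (fun π => h π.1 π.2) hC

def ringSeminorm : RingSeminorm P where
  toFun := F.seminorm
  map_zero' := le_antisymm (F.seminorm_le le_rfl fun π _ => by simp) (F.seminorm_nonneg 0)
  add_le' x y := F.seminorm_le (add_nonneg (F.seminorm_nonneg x) (F.seminorm_nonneg y))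
    fun π h => by
      rw [map_add]
      exact (norm_add_le _ _).trans (add_le_add (F.le_seminorm π h x) (F.le_seminorm π h y))
  neg' x := by simp [seminorm]
  mul_le' x y := F.seminorm_le (mul_nonneg (F.seminorm_nonneg x) (F.seminorm_nonneg y))
    fun π h => by
      rw [map_mul]
      exact (norm_mul_le _ _).trans (mul_le_mul (F.le_seminorm π h x) (F.le_seminorm π h y)
        (norm_nonneg _) (F.seminorm_nonneg x))

theorem seminorm_smul (c : ℂ) (x : P) : F.seminorm (c • x) = ‖c‖ * F.seminorm x := by
  simp only [seminorm, map_smul, norm_smul]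
  exact (Real.mul_iSup_of_nonneg (norm_nonneg c) _).symm

theorem seminorm_star (x : P) : F.seminorm (star x) = F.seminorm x := by
  simp [seminorm, map_star]

theorem seminorm_star_mul_self (x : P) :
    F.seminorm x * F.seminorm x ≤ F.seminorm (star x * x) := by
  have h : F.seminorm x ≤ √(F.seminorm (star x * x)) :=
    F.seminorm_le (Real.sqrt_nonneg _) fun π h => by
      apply Real.le_sqrt_of_sq_le
      have := F.le_seminorm π h (star x * x)
      rwa [map_mul, map_star, CStarRing.norm_star_mul_self, ← sq] at this
  calc _ ≤ √(F.seminorm (star x * x)) * √(F.seminorm (star x * x)) :=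
        mul_self_le_mul_self (F.seminorm_nonneg x) h
    _ = _ := Real.mul_self_sqrt (F.seminorm_nonneg _)

/-- The *-algebra `P` equipped with the seminorm of the family. -/
def Pre (_F : RepFamily P) : Type u := P

instance : Ring F.Pre := inferInstanceAs (Ring P)
instance : StarRing F.Pre := inferInstanceAs (StarRing P)
instance : Algebra ℂ F.Pre := inferInstanceAs (Algebra ℂ P)
instance [StarModule ℂ P] : StarModule ℂ F.Pre := inferInstanceAs (StarModule ℂ P)
def ringSeminormPre : RingSeminorm F.Pre := F.ringSeminorm

instance : SeminormedRing F.Pre := F.ringSeminormPre.toSeminormedRing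
instance : NormedAlgebra ℂ F.Pre where
  toAlgebra := inferInstance
  norm_smul_le c x := (F.seminorm_smul c x).le

def toPre : P →⋆ₐ[ℂ] F.Pre := StarAlgHom.id ℂ P

theorem norm_toPre (x : P) : ‖F.toPre x‖ = F.seminorm x := rfl

theorem norm_star_pre (x : F.Pre) : ‖star x‖ = ‖x‖ := F.seminorm_star x

/-- The Hausdorff completion of `P` in the seminorm of the family: the seminorm-zero elements are
divided out and the quotient is completed.  It is a unital C*-algebra (possibly zero). -/
def CStar (F : RepFamily P) : Type u := Completion F.Pre

instance : NormedRing F.CStar := inferInstanceAs (NormedRing (Completion F.Pre))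
instance : CompleteSpace F.CStar := inferInstanceAs (CompleteSpace (Completion F.Pre))
instance : NormedAlgebra ℂ F.CStar where
  toAlgebra := inferInstanceAs (Algebra ℂ (Completion F.Pre))
  norm_smul_le c x := norm_smul_le (β := Completion F.Pre) c x

/-- The canonical map from `P` to the completion. -/
def incl (x : P) : F.CStar := ((F.toPre x : F.Pre) : Completion F.Pre)

theorem norm_incl (x : P) : ‖F.incl x‖ = F.seminorm x :=
  Completion.norm_coe (E := F.Pre) _

theorem denseRange_incl : DenseRange F.incl :=
  Completion.denseRange_coe (α := F.Pre)

theorem incl_mul (x y : P) : F.incl (x * y) = F.incl x * F.incl y :=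
  Completion.coe_mul (α := F.Pre) x y

theorem incl_add (x y : P) : F.incl (x + y) = F.incl x + F.incl y :=
  Completion.coe_add (α := F.Pre) x y

theorem incl_smul (c : ℂ) (x : P) : F.incl (c • x) = c • F.incl x :=
  Completion.coe_smul (X := F.Pre) c x

theorem incl_one : F.incl 1 = 1 := rfl

instance : Star F.CStar where
  star := Completion.map (star : F.Pre → F.Pre)

theorem uniformContinuous_star_pre : UniformContinuous (star : F.Pre → F.Pre) :=
  (AddMonoidHomClass.isometry_of_norm (starAddEquiv : F.Pre ≃+ F.Pre)
    F.norm_star_pre).uniformContinuous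

theorem continuous_star_cstar : Continuous (star : F.CStar → F.CStar) :=
  Completion.continuous_map

theorem star_incl (x : P) : star (F.incl x) = F.incl (star x) :=
  Completion.map_coe F.uniformContinuous_star_pre _

@[elab_as_elim]
theorem incl_induction {p : F.CStar → Prop} (z : F.CStar) (hc : IsClosed {z | p z})
    (h : ∀ x, p (F.incl x)) : p z :=
  F.denseRange_incl.induction_on z hc h

instance : StarRing F.CStar where
  star_involutive z := by
    refine F.incl_induction z (isClosed_eq (F.continuous_star_cstar.comp F.continuous_star_cstar)
      continuous_id) fun x => ?_
    rw [star_incl, star_incl, star_star]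
  star_mul z w := by
    have hs := F.continuous_star_cstar
    refine F.incl_induction z (isClosed_eq (by fun_prop) (by fun_prop)) fun x => ?_
    refine F.incl_induction w (isClosed_eq (by fun_prop) (by fun_prop)) fun y => ?_
    rw [← incl_mul, star_incl, star_incl, star_incl, star_mul, incl_mul]
  star_add z w := by
    have hs := F.continuous_star_cstar
    refine F.incl_induction z (isClosed_eq (by fun_prop) (by fun_prop)) fun x => ?_
    refine F.incl_induction w (isClosed_eq (by fun_prop) (by fun_prop)) fun y => ?_
    rw [← incl_add, star_incl, star_incl, star_incl, star_add, incl_add]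

instance : CStarRing F.CStar where
  norm_mul_self_le z := by
    have hs := F.continuous_star_cstar
    refine F.incl_induction z (isClosed_le (by fun_prop) (by fun_prop)) fun x => ?_
    rw [star_incl, ← incl_mul, norm_incl, norm_incl]
    exact F.seminorm_star_mul_self x

instance [StarModule ℂ P] : StarModule ℂ F.CStar where
  star_smul c z := by
    have hs := F.continuous_star_cstar
    have hc : Continuous fun z : F.CStar => c • z := continuous_const_smul c
    have hc' : Continuous fun z : F.CStar => star c • z := continuous_const_smul (star c)
    refine F.incl_induction z (isClosed_eq (hs.comp hc) (hc'.comp hs)) fun x => ?_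
    rw [← incl_smul, star_incl, star_incl, star_smul, incl_smul]

instance [StarModule ℂ P] : CStarAlgebra F.CStar where

section Lift

/-- The canonical map as a *-homomorphism. -/
def inclHom [StarModule ℂ P] : P →⋆ₐ[ℂ] F.CStar where
  toFun := F.incl
  map_one' := F.incl_one
  map_mul' := F.incl_mul
  map_zero' := rfl
  map_add' := F.incl_add
  commutes' c := by rw [Algebra.algebraMap_eq_smul_one, incl_smul, incl_one,
    Algebra.algebraMap_eq_smul_one]
  map_star' x := (F.star_incl x).symm

variable {B : Type*} [CStarAlgebra B]

def preHom (f : P →⋆ₐ[ℂ] B) : F.Pre →+* B := (f : P →+* B)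

theorem continuous_preHom (f : P →⋆ₐ[ℂ] B) (h : ∀ x, ‖f x‖ ≤ F.seminorm x) :
    Continuous (F.preHom f) := by
  refine AddMonoidHomClass.continuous_of_bound (F.preHom f) 1 fun x => ?_
  rw [one_mul]
  exact h x

def liftRingHom (f : P →⋆ₐ[ℂ] B) (h : ∀ x, ‖f x‖ ≤ F.seminorm x) : F.CStar →+* B :=
  Completion.extensionHom (F.preHom f) (F.continuous_preHom f h)

theorem liftRingHom_incl (f : P →⋆ₐ[ℂ] B) (h : ∀ x, ‖f x‖ ≤ F.seminorm x) (x : P) :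
    F.liftRingHom f h (F.incl x) = f x :=
  Completion.extensionHom_coe (F.preHom f) (F.continuous_preHom f h) _

theorem continuous_liftRingHom (f : P →⋆ₐ[ℂ] B) (h : ∀ x, ‖f x‖ ≤ F.seminorm x) :
    Continuous (F.liftRingHom f h) :=
  Completion.continuous_extension (α := F.Pre)

/-- The extension of a *-homomorphism that is dominated by the seminorm. -/
def lift [StarModule ℂ P] (f : P →⋆ₐ[ℂ] B) (h : ∀ x, ‖f x‖ ≤ F.seminorm x) :
    F.CStar →⋆ₐ[ℂ] B :=
  { F.liftRingHom f h with
    commutes' := fun c => (F.liftRingHom_incl f h (algebraMap ℂ P c)).trans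
      (AlgHomClass.commutes f c)
    map_star' := fun z => by
      change F.liftRingHom f h (star z) = star (F.liftRingHom f h z)
      have hs := F.continuous_star_cstar
      have hG := F.continuous_liftRingHom f h
      refine F.incl_induction z (isClosed_eq (hG.comp hs) (continuous_star.comp hG)) fun x => ?_
      rw [star_incl, liftRingHom_incl, liftRingHom_incl, map_star] }

theorem lift_incl [StarModule ℂ P] (f : P →⋆ₐ[ℂ] B) (h : ∀ x, ‖f x‖ ≤ F.seminorm x) (x : P) :
    F.lift f h (F.incl x) = f x :=
  F.liftRingHom_incl f h x

/-- A representation of the family extends to the completion. -/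
def extend [StarModule ℂ P] (π : HilbRep P) (h : π ∈ F.carrier) : HilbRep F.CStar where
  space := π.space
  hom := F.lift π.hom (F.le_seminorm π h)

end Lift

end RepFamily


/-! ### minimal tensor product -/

theorem norm_complHom_le {E : Type u} [NormedAddCommGroup E] [InnerProductSpace ℂ E]
    (T : E →L[ℂ] E) : ‖complHom E T‖ ≤ ‖T‖ := by
  refine ContinuousLinearMap.opNorm_le_bound _ (norm_nonneg T) fun z => ?_
  refine Completion.induction_on z (isClosed_le (by fun_prop) (by fun_prop)) fun x => ?_
  rw [complHom_coe, Completion.norm_coe, Completion.norm_coe]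
  exact T.le_opNorm x

theorem norm_hom_le {A : Type u} [CStarAlgebra A] (π : HilbRep A) (a : A) : ‖π.hom a‖ ≤ ‖a‖ :=
  NonUnitalStarAlgHom.norm_apply_le π.hom a

section MinTensor

variable (A B C D : Type u) [CStarAlgebra A] [CStarAlgebra B] [CStarAlgebra C] [CStarAlgebra D]

/-- The representations `π ⊗ ρ` of the algebraic tensor product `A ⊗ B`, for all representations
`π` of `A` and `ρ` of `B` on Hilbert spaces. -/
def minFamily : RepFamily (A ⊗[ℂ] B) where
  carrier := {τ | ∃ (π : HilbRep A) (ρ : HilbRep B), τ = π.tensor ρ}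
  bdd x := by
    suffices h : ∃ K : ℝ, ∀ (π : HilbRep A) (ρ : HilbRep B), ‖(π.tensor ρ).hom x‖ ≤ K by
      obtain ⟨K, hK⟩ := h
      refine ⟨K, ?_⟩
      rintro _ ⟨⟨_, π, ρ, rfl⟩, rfl⟩
      exact hK π ρ
    induction x with
    | zero => exact ⟨0, fun π ρ => by simp⟩
    | add x y hx hy =>
      obtain ⟨K, hK⟩ := hx
      obtain ⟨L, hL⟩ := hy
      refine ⟨K + L, fun π ρ => ?_⟩
      rw [map_add]
      exact (norm_add_le _ _).trans (add_le_add (hK π ρ) (hL π ρ))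
    | tmul a b =>
      refine ⟨‖a‖ * ‖b‖, fun π ρ => ?_⟩
      change ‖complHom _ (HilbRep.algTensorHom π ρ (a ⊗ₜ b))‖ ≤ _
      rw [HilbRep.algTensorHom_tmul]
      refine (norm_complHom_le _).trans ((TensorProduct.norm_mapL_le _ _).trans ?_)
      exact mul_le_mul (norm_hom_le π a) (norm_hom_le ρ b) (norm_nonneg _) (norm_nonneg _)

/-- The minimal (spatial) tensor product of C*-algebras: the completion of the algebraic tensor
product in the norm `‖x‖ = sup ‖(π ⊗ ρ) x‖` over all representations `π` of `A`, `ρ` of `B`. -/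
abbrev MinTensor : Type u := (minFamily A B).CStar

variable {A B C D}

/-- The elementary tensor `a ⊗ b` in the minimal tensor product. -/
def MinTensor.tmul (a : A) (b : B) : MinTensor A B := (minFamily A B).incl (a ⊗ₜ[ℂ] b)

/-- The representation `π ⊗ ρ` of the minimal tensor product. -/
def HilbRep.minTensor (π : HilbRep A) (ρ : HilbRep B) : HilbRep (MinTensor A B) :=
  (minFamily A B).extend (π.tensor ρ) ⟨π, ρ, rfl⟩

/-- Composition of a representation with a *-homomorphism. -/
abbrev HilbRep.comp (π : HilbRep C) (f : A →⋆ₐ[ℂ] C) : HilbRep A where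
  space := π.space
  hom := π.hom.comp f

/-- `f ⊗ g` on the algebraic tensor product. -/
def algTensorMap (f : A →⋆ₐ[ℂ] C) (g : B →⋆ₐ[ℂ] D) : A ⊗[ℂ] B →⋆ₐ[ℂ] C ⊗[ℂ] D :=
  { Algebra.TensorProduct.map (f : A →ₐ[ℂ] C) (g : B →ₐ[ℂ] D) with
    map_star' := fun x => by
      change Algebra.TensorProduct.map (f : A →ₐ[ℂ] C) (g : B →ₐ[ℂ] D) (star x) =
        star (Algebra.TensorProduct.map (f : A →ₐ[ℂ] C) (g : B →ₐ[ℂ] D) x)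
      induction x with
      | zero => simp
      | add x y hx hy => rw [star_add, map_add, map_add, star_add, hx, hy]
      | tmul a b => simp [TensorProduct.star_tmul, map_star] }

theorem algTensorMap_tmul (f : A →⋆ₐ[ℂ] C) (g : B →⋆ₐ[ℂ] D) (a : A) (b : B) :
    algTensorMap f g (a ⊗ₜ b) = f a ⊗ₜ g b := rfl

theorem tensor_hom_algTensorMap (π : HilbRep C) (ρ : HilbRep D) (f : A →⋆ₐ[ℂ] C)
    (g : B →⋆ₐ[ℂ] D) (x : A ⊗[ℂ] B) :
    (π.tensor ρ).hom (algTensorMap f g x) = ((π.comp f).tensor (ρ.comp g)).hom x := by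
  change complHom _ (HilbRep.algTensorHom π ρ (algTensorMap f g x)) =
    complHom _ (HilbRep.algTensorHom (π.comp f) (ρ.comp g) x)
  congr 1
  induction x with
  | zero => simp
  | add x y hx hy => rw [map_add, map_add, map_add, hx, hy]
  | tmul a b => rw [algTensorMap_tmul, HilbRep.algTensorHom_tmul, HilbRep.algTensorHom_tmul]; rfl

/-- `f ⊗ g` on the minimal tensor product. -/
def MinTensor.map (f : A →⋆ₐ[ℂ] C) (g : B →⋆ₐ[ℂ] D) : MinTensor A B →⋆ₐ[ℂ] MinTensor C D :=
  (minFamily A B).lift ((minFamily C D).inclHom.comp (algTensorMap f g)) fun x => by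
    change ‖(minFamily C D).incl (algTensorMap f g x)‖ ≤ _
    rw [RepFamily.norm_incl]
    refine RepFamily.seminorm_le _ (RepFamily.seminorm_nonneg _ _) ?_
    rintro _ ⟨π, ρ, rfl⟩
    rw [tensor_hom_algTensorMap]
    exact RepFamily.le_seminorm (minFamily A B) _ ⟨π.comp f, ρ.comp g, rfl⟩ x

theorem MinTensor.map_tmul (f : A →⋆ₐ[ℂ] C) (g : B →⋆ₐ[ℂ] D) (a : A) (b : B) :
    MinTensor.map f g (MinTensor.tmul a b) = MinTensor.tmul (f a) (g b) :=
  RepFamily.lift_incl _ _ _ _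

/-- The elementary tensor `ξ ⊗ η` in the Hilbert space of `π ⊗ ρ`. -/
def HilbRep.vec (π : HilbRep A) (ρ : HilbRep B) (ξ : π.space) (η : ρ.space) :
    (π.minTensor ρ).space :=
  ((ξ ⊗ₜ[ℂ] η : π.space ⊗[ℂ] ρ.space) : Completion (π.space ⊗[ℂ] ρ.space))

theorem HilbRep.minTensor_hom_tmul (π : HilbRep A) (ρ : HilbRep B) (a : A) (b : B)
    (ξ : π.space) (η : ρ.space) :
    (π.minTensor ρ).hom (MinTensor.tmul a b) (π.vec ρ ξ η) = π.vec ρ (π.hom a ξ) (ρ.hom b η) := by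
  have h : (π.minTensor ρ).hom (MinTensor.tmul a b) = (π.tensor ρ).hom (a ⊗ₜ[ℂ] b) :=
    RepFamily.lift_incl _ _ _ _
  rw [h]
  exact HilbRep.tensor_hom_tmul π ρ a b ξ η

theorem HilbRep.inner_vec (π : HilbRep A) (ρ : HilbRep B) (ξ ξ' : π.space) (η η' : ρ.space) :
    ⟪π.vec ρ ξ η, π.vec ρ ξ' η'⟫_ℂ = ⟪ξ, ξ'⟫_ℂ * ⟪η, η'⟫_ℂ :=
  (Completion.inner_coe _ _).trans (TensorProduct.inner_tmul ..)

/-- `s` and `t` correspond to each other under the canonical isomorphism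
`(A ⊗ B) ⊗ C ≃ A ⊗ (B ⊗ C)`, that is, they are the same operator on `H ⊗ K ⊗ L` for all
representations of `A`, `B`, `C` on Hilbert spaces `H`, `K`, `L`.  The two algebras are faithfully
represented on these spaces, where elementary tensors are total, so equality of the matrix entries
at elementary tensors is equality of the operators. -/
def MinTensor.AssocEq (s : MinTensor (MinTensor A B) C) (t : MinTensor A (MinTensor B C)) : Prop :=
  ∀ (π : HilbRep A) (ρ : HilbRep B) (σ : HilbRep C) (ξ ξ' : π.space) (η η' : ρ.space)
    (ζ ζ' : σ.space),
    ⟪(π.minTensor ρ).vec σ (π.vec ρ ξ' η') ζ',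
      ((π.minTensor ρ).minTensor σ).hom s ((π.minTensor ρ).vec σ (π.vec ρ ξ η) ζ)⟫_ℂ =
    ⟪π.vec (ρ.minTensor σ) ξ' (ρ.vec σ η' ζ'),
      (π.minTensor (ρ.minTensor σ)).hom t (π.vec (ρ.minTensor σ) ξ (ρ.vec σ η ζ))⟫_ℂ

theorem MinTensor.assocEq_tmul (a : A) (b : B) (c : C) :
    MinTensor.AssocEq (MinTensor.tmul (MinTensor.tmul a b) c)
      (MinTensor.tmul a (MinTensor.tmul b c)) := by
  intro π ρ σ ξ ξ' η η' ζ ζ'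
  simp only [HilbRep.minTensor_hom_tmul, HilbRep.inner_vec, mul_assoc]

end MinTensor

/-- `(A, Δ)` is a compact quantum group: `Δ` is coassociative, `(Δ ⊗ id) Δ = (id ⊗ Δ) Δ`, and the
spans of `(1 ⊗ A) Δ(A)` and `(A ⊗ 1) Δ(A)` are dense in `A ⊗ A`. -/
structure IsCompactQuantumGroup {A : Type u} [CStarAlgebra A] (Δ : A →⋆ₐ[ℂ] MinTensor A A) :
    Prop where
  coassoc : ∀ a, MinTensor.AssocEq (MinTensor.map Δ (StarAlgHom.id ℂ A) (Δ a))
    (MinTensor.map (StarAlgHom.id ℂ A) Δ (Δ a))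
  dense_right : Dense (Submodule.span ℂ
    {z : MinTensor A A | ∃ a b : A, z = MinTensor.tmul 1 a * Δ b} : Set (MinTensor A A))
  dense_left : Dense (Submodule.span ℂ
    {z : MinTensor A A | ∃ a b : A, z = MinTensor.tmul a 1 * Δ b} : Set (MinTensor A A))

/-! ### free star algebra -/

/-- The free unital complex *-algebra on self-adjoint generators indexed by `X`: noncommutative
polynomials, with the conjugate-linear involution that reverses words and fixes the generators. -/
def FreeStar (X : Type u) : Type u := FreeAlgebra ℂ X

namespace FreeStar

variable {X : Type u}

instance : Ring (FreeStar X) := inferInstanceAs (Ring (FreeAlgebra ℂ X))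
instance : Algebra ℂ (FreeStar X) := inferInstanceAs (Algebra ℂ (FreeAlgebra ℂ X))

/-- The generators. -/
def gen (x : X) : FreeStar X := FreeAlgebra.ι ℂ x

/-- The opposite algebra with conjugated scalars, through which the involution is defined. -/
def ConjOp (X : Type u) : Type u := (FreeStar X)ᵐᵒᵖ

instance : Ring (ConjOp X) := inferInstanceAs (Ring (FreeStar X)ᵐᵒᵖ)

instance : Algebra ℂ (ConjOp X) :=
  RingHom.toAlgebra'
    ((((algebraMap ℂ (FreeStar X)).comp (starRingEnd ℂ)).toOpposite
      fun c d => Algebra.commutes (starRingEnd ℂ c) (algebraMap ℂ (FreeStar X) (starRingEnd ℂ d))) : ℂ →+* (FreeStar X)ᵐᵒᵖ)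
    fun c x => MulOpposite.unop_injective
      (Algebra.commutes (starRingEnd ℂ c) (MulOpposite.unop x)).symm

/-- The involution as an algebra homomorphism to the conjugate opposite algebra. -/
def starHom : FreeStar X →ₐ[ℂ] ConjOp X :=
  FreeAlgebra.lift ℂ fun x => (MulOpposite.op (gen x) : (FreeStar X)ᵐᵒᵖ)

/-- The involution. -/
def starFun (x : FreeStar X) : FreeStar X := MulOpposite.unop (starHom x : (FreeStar X)ᵐᵒᵖ)

theorem starFun_gen (x : X) : starFun (gen x) = gen x :=
  congrArg (fun z : (FreeStar X)ᵐᵒᵖ => MulOpposite.unop z) (FreeAlgebra.lift_ι_apply (A := ConjOp X) _ x)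

theorem starFun_algebraMap (c : ℂ) :
    starFun (algebraMap ℂ (FreeStar X) c) = algebraMap ℂ (FreeStar X) (starRingEnd ℂ c) :=
  congrArg (fun z : (FreeStar X)ᵐᵒᵖ => MulOpposite.unop z) (starHom.commutes c)

theorem starFun_mul (x y : FreeStar X) : starFun (x * y) = starFun y * starFun x :=
  congrArg (fun z : (FreeStar X)ᵐᵒᵖ => MulOpposite.unop z) (map_mul starHom x y)

theorem starFun_add (x y : FreeStar X) : starFun (x + y) = starFun x + starFun y :=
  congrArg (fun z : (FreeStar X)ᵐᵒᵖ => MulOpposite.unop z) (map_add starHom x y)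

@[elab_as_elim]
theorem induct {p : FreeStar X → Prop} (z : FreeStar X)
    (hc : ∀ c, p (algebraMap ℂ (FreeStar X) c)) (hg : ∀ x, p (gen x))
    (hm : ∀ x y, p x → p y → p (x * y)) (ha : ∀ x y, p x → p y → p (x + y)) : p z :=
  FreeAlgebra.induction (motive := p) ℂ X hc hg hm ha z

instance : StarRing (FreeStar X) where
  star := starFun
  star_involutive z := by
    refine induct z (fun c => ?_) (fun x => ?_) (fun x y hx hy => ?_) (fun x y hx hy => ?_)
    · rw [starFun_algebraMap, starFun_algebraMap, Complex.conj_conj]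
    · rw [starFun_gen, starFun_gen]
    · rw [starFun_mul, starFun_mul, hx, hy]
    · rw [starFun_add, starFun_add, hx, hy]
  star_mul := starFun_mul
  star_add := starFun_add

theorem star_gen (x : X) : star (gen x) = gen x := starFun_gen x

instance : StarModule ℂ (FreeStar X) where
  star_smul c z := by
    rw [Algebra.smul_def, star_mul, Algebra.smul_def, Algebra.commutes (star c) (star z)]
    exact congrArg (star z * ·) (starFun_algebraMap c)

end FreeStar

/-- The representations on Hilbert spaces in which all generators are projections (they are
self-adjoint already) and all the relations `r = 0`, `r ∈ R`, hold. -/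
def projFamily (X : Type u) (R : Set (FreeStar X)) : RepFamily (FreeStar X) where
  carrier := {π | (∀ x, IsIdempotentElem (π.hom (FreeStar.gen x))) ∧ ∀ r ∈ R, π.hom r = 0}
  bdd z := by
    suffices h : ∃ K : ℝ, ∀ π : HilbRep (FreeStar X),
        (∀ x, IsIdempotentElem (π.hom (FreeStar.gen x))) → ‖π.hom z‖ ≤ K by
      obtain ⟨K, hK⟩ := h
      refine ⟨K, ?_⟩
      rintro _ ⟨⟨π, hπ, -⟩, rfl⟩
      exact hK π hπ
    refine FreeStar.induct z (fun c => ⟨‖c‖, fun π _ => ?_⟩) (fun x => ⟨1, fun π hπ => ?_⟩) ?_ ?_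
    · rw [AlgHomClass.commutes π.hom, Algebra.algebraMap_eq_smul_one, norm_smul]
      exact mul_le_of_le_one_right (norm_nonneg c) ContinuousLinearMap.norm_id_le
    · have h1 : star (π.hom (FreeStar.gen x)) * π.hom (FreeStar.gen x) =
          π.hom (FreeStar.gen x) := by
        rw [← map_star, FreeStar.star_gen]
        exact hπ x
      have h2 := CStarRing.norm_star_mul_self (x := π.hom (FreeStar.gen x))
      rw [h1] at h2
      nlinarith [norm_nonneg (π.hom (FreeStar.gen x))]
    · rintro x y ⟨K, hK⟩ ⟨L, hL⟩
      refine ⟨|K| * L, fun π hπ => ?_⟩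
      rw [map_mul]
      exact (norm_mul_le _ _).trans (mul_le_mul ((hK π hπ).trans (le_abs_self K)) (hL π hπ)
        (norm_nonneg _) (abs_nonneg K))
    · rintro x y ⟨K, hK⟩ ⟨L, hL⟩
      refine ⟨K + L, fun π hπ => ?_⟩
      rw [map_add]
      exact (norm_add_le _ _).trans (add_le_add (hK π hπ) (hL π hπ))

/-- The universal C*-algebra generated by projections indexed by `X` subject to the relations
`r = 0`, `r ∈ R`: the completion in the supremum of the norms in all representations. -/
abbrev ProjCStar (X : Type u) (R : Set (FreeStar X)) : Type u := (projFamily X R).CStar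

/-- The canonical generators. -/
def ProjCStar.gen {X : Type u} (R : Set (FreeStar X)) (x : X) : ProjCStar X R :=
  (projFamily X R).incl (FreeStar.gen x)

/-! ### games -/

section Game

variable {W : Type u}

/-- A game with question set and answer set `W` is given by its predicate; `V a b x y` is
`V(a, b | x, y)`.  It is synchronous if `V(a, b | x, x) = 0` for `a ≠ b`. -/
def IsSynchronous (V : W → W → W → W → Fin 2) : Prop :=
  ∀ x a b, a ≠ b → V a b x x = 0

/-- A synchronous game is bisynchronous if moreover `V(a, a | x, y) = 0` for `x ≠ y`. -/
def IsBisynchronous (V : W → W → W → W → Fin 2) : Prop :=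
  IsSynchronous V ∧ ∀ a x y, x ≠ y → V a a x y = 0

/-- If `V(a, b | r, s) = V(r, s | x, y) = 1` for some `r, s`, then `V(a, b | x, y) = 1`. -/
def IsTransitive (V : W → W → W → W → Fin 2) : Prop :=
  ∀ a b x y, (∃ r s, V a b r s = 1 ∧ V r s x y = 1) → V a b x y = 1

variable [Fintype W]

/-- The relations `∑ a, u (x, a) = 1`, and `u (x, a) * u (y, b) = 0` whenever `V(a, b | x, y) = 0`. -/
def gameRelations (V : W → W → W → W → Fin 2) : Set (FreeStar (W × W)) :=
  {r | ∃ x, r = ∑ a, FreeStar.gen (x, a) - 1} ∪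
  {r | ∃ a b x y, V a b x y = 0 ∧ r = FreeStar.gen (x, a) * FreeStar.gen (y, b)}

/-- The C*-algebra of the game: the universal C*-algebra generated by projections `u (x, a)` with the
relations of the game. -/
abbrev GameCStar (V : W → W → W → W → Fin 2) : Type u := ProjCStar (W × W) (gameRelations V)

/-- The canonical generators `u (x, a)` of the C*-algebra of a game. -/
def GameCStar.gen (V : W → W → W → W → Fin 2) (x a : W) : GameCStar V :=
  ProjCStar.gen (gameRelations V) (x, a)

/-- The game has a perfect C*-strategy: its universal C*-algebra is not zero. -/
def HasPerfectCStarStrategy (V : W → W → W → W → Fin 2) : Prop := Nontrivial (GameCStar V)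

variable [DecidableEq W]

/-- The matrix of the free generators. -/
def genericMatrix (W : Type u) : Matrix W W (FreeStar (W × W)) :=
  Matrix.of fun i j => FreeStar.gen (i, j)

/-- The relations `U U* = 1 = U* U` for the matrix of the generators. -/
def magicRelations (W : Type u) [Fintype W] [DecidableEq W] : Set (FreeStar (W × W)) :=
  {r | ∃ i j, r = (genericMatrix W * (genericMatrix W).conjTranspose - 1) i j} ∪
  {r | ∃ i j, r = ((genericMatrix W).conjTranspose * genericMatrix W - 1) i j}

/-- The C*-algebra of the quantum permutation group of all permutations of `W`: the universal
C*-algebra generated by the entries of a magic unitary (a unitary matrix of projections). -/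
abbrev SPlus (W : Type u) [Fintype W] [DecidableEq W] : Type u :=
  ProjCStar (W × W) (magicRelations W)

/-- The canonical generators of the universal magic unitary. -/
def SPlus.gen (i j : W) : SPlus W := ProjCStar.gen (magicRelations W) (i, j)

/-- `(A, Δ)` is a quantum permutation group acting on `W`: a compact quantum group with a surjective
unital *-homomorphism `π` from the C*-algebra of the full quantum permutation group, compatible with
the comultiplications, so that `[π u_{ij}]` is a (fundamental) representation. -/
structure IsQuantumPermutationGroup {A : Type u} [CStarAlgebra A]
    (Δ : A →⋆ₐ[ℂ] MinTensor A A) (π : SPlus W →⋆ₐ[ℂ] A) : Prop where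
  isCompactQuantumGroup : IsCompactQuantumGroup Δ
  surjective : Function.Surjective π
  comul : ∀ i j, Δ (π (SPlus.gen i j)) =
    ∑ k, MinTensor.tmul (π (SPlus.gen i k)) (π (SPlus.gen k j))

/-- `(i, i') ∼ (j, j')` if `v i j * v i' j' ≠ 0`. -/
def OrbitalRel {A : Type u} [CStarAlgebra A] (v : W → W → A) (p q : W × W) : Prop :=
  v p.1 q.1 * v p.2 q.2 ≠ 0

/-- The quantum orbitals: the classes of `OrbitalRel` on `W × W`. -/
def quantumOrbitals {A : Type u} [CStarAlgebra A] (v : W → W → A) : Set (Set (W × W)) :=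
  {O | ∃ p, O = {q | OrbitalRel v p q}}

end Game

end QPG
end

open QPG

/-! The heart is transitivity of the orbital relation. Since the rows of `u` are orthogonal,
multiplying `Δ (u i j)` by `u i k ⊗ 1` isolates one summand, so (u_{p1,q1} ⊗ 1) Δ(u_{p1,r1}
u_{p2,r2}) (u_{p2,q2} ⊗ 1) = u_{p1,q1} u_{p2,q2} ⊗ u_{q1,r1} u_{q2,r2}. If p ∼ q and q ∼ r, the
right side is nonzero because elementary tensors of nonzero elements are nonzero
(`MinTensor.tmul_ne_zero`); hence p ∼ r (`orbitalRel_trans`). This is also the transitivity of the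
game; bisynchronicity is orthogonality in rows and columns.

Reflexivity and symmetry then follow without antipode or Haar state. The positive elements u_{p1,q1}
u_{p2,q2} u_{p1,q1} form a doubly stochastic matrix over `A` whose support is the orbital relation,
so by double counting a set closed under successors is closed under predecessors
(`mem_of_orbitalRel`).

In the game algebra, the relations of a bisynchronous game force the columns, too, to sum to 1, so
the generators form a magic unitary. Transitivity says exactly what is needed for the matrix ∑
v_{x,r} ⊗ v_{r,a} to satisfy the relations of the game, and the universal property gives the
comultiplication. Coassociativity and the density conditions reduce to generators
(`coassoc_of_denseRange`, `dense_span_mul_of_gen`).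

Finally v_{x,a} ↦ u_{x,a} defines a homomorphism θ from the game algebra to `A`. It makes the game
algebra nonzero and shows that a product of two generators vanishes there only if it vanishes in
`A`; the converse is a relation of the game. So the orbitals agree.

Norms here are suprema over Hilbert space representations. The GNS construction supplies enough of
these, both for nonvanishing of tensors and for the universal property with values in an abstract
C*-algebra. -/

noncomputable section

namespace QPG

/-! ### States, the GNS representation and sums of projections -/

section States

open scoped ComplexOrder

attribute [local instance] CStarAlgebra.spectralOrder CStarAlgebra.spectralOrderedRing

variable {A : Type u} [CStarAlgebra A]

/-- A contractive functional with `φ 1 = 1` is real on self-adjoint elements. -/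
theorem im_eq_zero_of_norm_le_one [Nontrivial A] (φ : StrongDual ℂ A) (hφ : ‖φ‖ ≤ 1)
    (h1 : φ 1 = 1) {a : A} (ha : IsSelfAdjoint a) : (φ a).im = 0 := by
  -- The imaginary shift a + it moves φ a by it, while the C*-identity bounds its squared norm by
  -- ‖a‖² + t². The t² cancels, leaving a bound on a term linear in t.
  have key : ∀ t : ℝ, ((φ a).im + t) ^ 2 ≤ ‖a‖ ^ 2 + t ^ 2 := by
    intro t
    set z : A := a + (t * Complex.I) • (1 : A) with hz
    have hφz : φ z = φ a + t * Complex.I := by simp [hz, h1]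
    have hle : ‖φ z‖ ≤ ‖z‖ := by
      simpa using φ.le_of_opNorm_le hφ z
    have hzz : star z * z = a * a + ((t ^ 2 : ℝ) : ℂ) • (1 : A) := by
      have hs : star z = a - (t * Complex.I) • (1 : A) := by
        simp [hz, ha.star_eq, sub_eq_add_neg]
      rw [hs, hz, sub_mul, mul_add, mul_add, mul_smul_one, smul_one_mul, smul_mul_smul_comm,
        one_mul]
      have : (t * Complex.I) * (t * Complex.I) = -((t ^ 2 : ℝ) : ℂ) := by
        push_cast
        linear_combination (t : ℂ) ^ 2 * Complex.I_mul_I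
      rw [this, neg_smul]
      abel
    have hn : ‖z‖ ^ 2 ≤ ‖a‖ ^ 2 + t ^ 2 := by
      rw [sq, ← CStarRing.norm_star_mul_self, hzz]
      refine (norm_add_le _ _).trans (add_le_add ((norm_mul_le _ _).trans (sq _).ge) ?_)
      rw [norm_smul, norm_one, mul_one, Complex.norm_real, Real.norm_of_nonneg (sq_nonneg t)]
    have him : |(φ a).im + t| ≤ ‖φ z‖ := by
      have := Complex.abs_im_le_norm (φ z)
      rwa [hφz, Complex.add_im, Complex.mul_I_im, Complex.ofReal_re, ← hφz] at this
    calc ((φ a).im + t) ^ 2 = |(φ a).im + t| ^ 2 := (sq_abs _).symm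
      _ ≤ ‖z‖ ^ 2 := by gcongr; exact him.trans hle
      _ ≤ _ := hn
  by_contra hne
  -- This t makes the cross term 2 t Im φ(a) equal to ‖a‖² + 1, more than the bound ‖a‖².
  have := key ((‖a‖ ^ 2 + 1) / (2 * (φ a).im))
  have h2 : 2 * (φ a).im * ((‖a‖ ^ 2 + 1) / (2 * (φ a).im)) = ‖a‖ ^ 2 + 1 := by
    field_simp
  nlinarith [sq_nonneg (φ a).im]

/-- A contractive functional with `φ 1 = 1` is positive. -/
theorem nonneg_of_norm_le_one [Nontrivial A] (φ : StrongDual ℂ A) (hφ : ‖φ‖ ≤ 1)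
    (h1 : φ 1 = 1) {a : A} (ha : 0 ≤ a) : 0 ≤ φ a := by
  have hsa : IsSelfAdjoint a := .of_nonneg ha
  have him := im_eq_zero_of_norm_le_one φ hφ h1 hsa
  -- From 0 ≤ ‖a‖ - a ≤ ‖a‖. Applying φ puts φ a in the disc of radius ‖a‖ about ‖a‖, hence in the
  -- right half-plane.
  have hle : ‖algebraMap ℝ A ‖a‖ - a‖ ≤ ‖a‖ := by
    have h0 : 0 ≤ algebraMap ℝ A ‖a‖ - a := sub_nonneg.2 (IsSelfAdjoint.le_algebraMap_norm_self hsa)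
    refine (CStarAlgebra.norm_le_norm_of_nonneg_of_le h0 (sub_le_self _ ha)).trans ?_
    rw [norm_algebraMap', norm_norm]
  have h2 : ‖φ (algebraMap ℝ A ‖a‖ - a)‖ ≤ ‖a‖ := by
    refine le_trans ?_ hle
    simpa using φ.le_of_opNorm_le hφ (algebraMap ℝ A ‖a‖ - a)
  have h3 : φ (algebraMap ℝ A ‖a‖ - a) = ‖a‖ - φ a := by
    rw [map_sub, Algebra.algebraMap_eq_smul_one, ← Complex.coe_smul, map_smul, h1, smul_eq_mul,
      mul_one]
  rw [h3] at h2
  have h4 := (Complex.abs_re_le_norm _).trans h2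
  rw [Complex.sub_re, Complex.ofReal_re] at h4
  exact Complex.nonneg_iff.2 ⟨by linarith [(abs_le.1 h4).2], him.symm⟩

/-- A positive element attains its norm on a state. -/
theorem exists_state_apply_eq_norm [Nontrivial A] {a : A} (ha : 0 ≤ a) :
    ∃ φ : A →ₚ[ℂ] ℂ, φ 1 = 1 ∧ φ a = ‖a‖ := by
  -- The norm of a + 1 is ‖a‖ + 1, so a functional of norm one that norms a + 1 must norm both a and
  -- 1: it is automatically a state.
  have hmem : ‖a‖ + 1 ∈ spectrum ℝ (a + 1) := by
    have := CStarAlgebra.norm_mem_spectrum_of_nonneg ha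
    rw [← map_one (algebraMap ℝ A)]
    rwa [add_comm a, spectrum.add_mem_add_iff]
  have hge : ‖a‖ + 1 ≤ ‖a + 1‖ := (le_abs_self _).trans (spectrum.norm_le_norm_of_mem hmem)
  obtain ⟨φ, hφ, hφa⟩ := exists_dual_vector ℂ (a + 1) (by linarith [norm_nonneg a])
  have hb : ∀ x, ‖φ x‖ ≤ ‖x‖ := fun x => by simpa using φ.le_of_opNorm_le hφ.le x
  have hsum : (φ a).re + (φ 1).re = ‖a + 1‖ := by
    have := congrArg Complex.re hφa
    rwa [map_add, Complex.add_re] at this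
  have hra := (Complex.re_le_norm (φ a)).trans (hb a)
  have hr1 := (Complex.re_le_norm (φ 1)).trans (hb 1)
  rw [norm_one] at hr1
  have eq_of_re {z : ℂ} {r : ℝ} (hz : ‖z‖ ≤ r) (hr : r ≤ z.re) : z = r := by
    have h1 : z.re = r := le_antisymm ((Complex.re_le_norm z).trans hz) hr
    have h2 : z.re = ‖z‖ := le_antisymm (Complex.re_le_norm z) (hz.trans hr)
    have h3 := Complex.re_eq_norm.1 h2
    exact Complex.ext (by simpa using h1) (by simpa using (Complex.nonneg_iff.1 h3).2.symm)
  have h1 : φ 1 = 1 := by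
    have := eq_of_re (z := φ 1) (r := 1) (by simpa using hb 1) (by linarith)
    simpa using this
  refine ⟨PositiveLinearMap.mk₀ φ.toLinearMap
    fun x hx => nonneg_of_norm_le_one φ hφ.le h1 hx, h1, ?_⟩
  change φ a = ‖a‖
  exact eq_of_re (hb a) (by linarith)

/-- Every element of a C*-algebra attains its norm in a representation. -/
theorem exists_hilbRep_norm_le [Nontrivial A] (a : A) : ∃ π : HilbRep A, ‖a‖ ≤ ‖π.hom a‖ := by
  obtain ⟨φ, h1, hφ⟩ := exists_state_apply_eq_norm (star_mul_self_nonneg a)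
  refine ⟨⟨φ.GNS, φ.gnsStarAlgHom⟩, ?_⟩
  -- The cyclic vector: ‖ξ‖² = φ(1) = 1 and ‖aξ‖² = φ(a*a) = ‖a*a‖ = ‖a‖².
  set ξ : φ.GNS := ((φ.toPreGNS 1 : φ.PreGNS) : Completion φ.PreGNS) with hξ
  have hξ1 : ‖ξ‖ ^ 2 = 1 := by
    have := φ.preGNS_norm_sq (φ.toPreGNS 1)
    rw [φ.ofPreGNS_toPreGNS, star_one, one_mul, h1] at this
    rw [hξ, Completion.norm_coe]
    exact_mod_cast this
  have hξa : ‖φ.gnsStarAlgHom a ξ‖ ^ 2 = ‖a‖ ^ 2 := by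
    have h2 : φ.gnsStarAlgHom a ξ = ((φ.toPreGNS a : φ.PreGNS) : Completion φ.PreGNS) := by
      have : φ.gnsStarAlgHom a ξ = φ.gnsNonUnitalStarAlgHom a ξ := rfl
      rw [this, hξ, φ.gnsNonUnitalStarAlgHom_apply_coe]
      simp
    have := φ.preGNS_norm_sq (φ.toPreGNS a)
    rw [φ.ofPreGNS_toPreGNS, hφ, CStarRing.norm_star_mul_self, ← sq] at this
    rw [h2, Completion.norm_coe]
    exact_mod_cast this
  have h3 : ‖ξ‖ = 1 := (pow_eq_one_iff_of_nonneg (norm_nonneg ξ) two_ne_zero).1 hξ1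
  have h4 : ‖φ.gnsStarAlgHom a ξ‖ = ‖a‖ :=
    (pow_left_inj₀ (norm_nonneg _) (norm_nonneg _) two_ne_zero).1 hξa
  have h5 := (φ.gnsStarAlgHom a).le_opNorm ξ
  rwa [h3, mul_one, h4] at h5

/-- Reduces domination of a homomorphism into an abstract C*-algebra to its compositions with
Hilbert space representations, which is how the universal seminorms are defined. -/
theorem norm_le_of_forall_hilbRep {a : A} {C : ℝ} (hC : 0 ≤ C)
    (h : ∀ π : HilbRep A, ‖π.hom a‖ ≤ C) : ‖a‖ ≤ C := by
  rcases subsingleton_or_nontrivial A with _ | _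
  · rwa [Subsingleton.elim a 0, norm_zero]
  · obtain ⟨π, hπ⟩ := exists_hilbRep_norm_le a
    exact hπ.trans (h π)

theorem exists_hilbRep_ne_zero {a : A} (ha : a ≠ 0) :
    ∃ (π : HilbRep A) (ξ : π.space), π.hom a ξ ≠ 0 := by
  have : Nontrivial A := ⟨a, 0, ha⟩
  obtain ⟨π, hπ⟩ := exists_hilbRep_norm_le a
  refine ⟨π, ?_⟩
  by_contra! h
  have h0 : π.hom a = 0 := ContinuousLinearMap.ext h
  rw [h0, norm_zero] at hπ
  exact ha (norm_le_zero_iff.1 hπ)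

theorem eq_zero_of_isStarProjection_sum {ι : Type*} {s : Finset ι} {p : ι → A}
    (hp : ∀ i ∈ s, IsStarProjection (p i)) (h : ∑ i ∈ s, p i = 0) : ∀ i ∈ s, p i = 0 :=
  (Finset.sum_eq_zero_iff_of_nonneg fun i hi => (hp i hi).nonneg).1 h

/-- Projections that sum to `1` are mutually orthogonal. -/
theorem mul_eq_zero_of_sum_eq_one {ι : Type*} [Fintype ι] {p : ι → A}
    (hp : ∀ i, IsStarProjection (p i)) (h : ∑ i, p i = 1) {i j : ι} (hij : i ≠ j) :
    p i * p j = 0 := by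
  classical
  -- The complement 1 - p i is the sum of the other projections, each positive; for projections,
  -- order is absorption under multiplication.
  have hle : p j ≤ 1 - p i := by
    rw [← h, ← Finset.add_sum_erase _ _ (Finset.mem_univ i), add_sub_cancel_left]
    exact Finset.single_le_sum (f := p) (fun k _ => (hp k).nonneg)
      (Finset.mem_erase.2 ⟨hij.symm, Finset.mem_univ j⟩)
  have := ((hp j).le_iff_mul_eq_right (hp i).one_sub).1 hle
  rwa [sub_mul, one_mul, sub_eq_self] at this

/-- Each term is (qp)*(qp), hence positive, so no cancellation is possible, and the C*-identity
gives qp = 0. -/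
theorem eq_zero_of_sum_conj_eq_zero {ι : Type*} {s : Finset ι} {p q : ι → A}
    (hp : ∀ i ∈ s, IsStarProjection (p i)) (hq : ∀ i ∈ s, IsStarProjection (q i))
    (h : ∑ i ∈ s, p i * q i * p i = 0) : ∀ i ∈ s, q i * p i = 0 := by
  have key : ∀ i ∈ s, p i * q i * p i = star (q i * p i) * (q i * p i) := fun i hi => by
    rw [star_mul, (hp i hi).isSelfAdjoint.star_eq, (hq i hi).isSelfAdjoint.star_eq, mul_assoc,
      mul_assoc, ← mul_assoc (q i) (q i), (hq i hi).isIdempotentElem.eq]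
  rw [Finset.sum_congr rfl key,
    Finset.sum_eq_zero_iff_of_nonneg fun i _ => star_mul_self_nonneg _] at h
  exact fun i hi => CStarRing.star_mul_self_eq_zero_iff _ |>.1 (h i hi)

end States

/-! ### Closed range of *-homomorphisms -/

section Surjective

variable {A B : Type*} [CStarAlgebra A] [CStarAlgebra B]

theorem continuous_starAlgHom  (f : A →⋆ₐ[ℂ] B) : Continuous f :=
  AddMonoidHomClass.continuous_of_bound f 1 fun x => by
    rw [one_mul]
    exact NonUnitalStarAlgHom.norm_apply_le f x

/-- Truncating a to [-M, M], M = ‖f a‖, by functional calculus leaves its image unchanged: f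
commutes with the calculus and the spectrum of f a already lies in that interval. -/
theorem exists_preimage_norm_le_of_isSelfAdjoint (f : A →⋆ₐ[ℂ] B) {a : A}
    (ha : IsSelfAdjoint a) : ∃ a', f a' = f a ∧ ‖a'‖ ≤ ‖f a‖ := by
  rcases subsingleton_or_nontrivial B with _ | _
  · exact ⟨0, Subsingleton.elim _ _, by simp⟩
  set M := ‖f a‖
  have hfa : IsSelfAdjoint (f a) := ha.map f
  have hcont : Continuous fun t : ℝ => max (-M) (min t M) := by fun_prop
  refine ⟨cfc (fun t : ℝ => max (-M) (min t M)) a, ?_, ?_⟩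
  · rw [StarAlgHomClass.map_cfc (S := ℂ) f (fun t : ℝ => max (-M) (min t M)) a
      hcont.continuousOn (continuous_starAlgHom f) ha hfa]
    conv_rhs => rw [← cfc_id ℝ (f a)]
    refine cfc_congr fun t ht => ?_
    have := abs_le.1 (spectrum.norm_le_norm_of_mem ht)
    rw [min_eq_left this.2, max_eq_right this.1, id]
  · refine norm_cfc_le (norm_nonneg _) fun t _ => ?_
    rw [Real.norm_eq_abs, abs_le]
    exact ⟨le_max_left _ _, max_le (by linarith [norm_nonneg (f a)]) (min_le_right _ _)⟩

/-- The factor 2 comes from lifting real and imaginary parts separately. Any constant would serve: a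
uniform bound on preimages is what makes the range closed. -/
theorem exists_preimage_norm_le (f : A →⋆ₐ[ℂ] B) (a : A) :
    ∃ a', f a' = f a ∧ ‖a'‖ ≤ 2 * ‖f a‖ := by
  have hre : f (realPart a : A) = (realPart (f a) : B) := by
    simp [realPart_apply_coe, map_star, ← Complex.coe_smul]
  have him : f (imaginaryPart a : A) = (imaginaryPart (f a) : B) := by
    simp [imaginaryPart_apply_coe, map_star, ← Complex.coe_smul]
  obtain ⟨x, hx, hx'⟩ := exists_preimage_norm_le_of_isSelfAdjoint f (realPart a).2
  obtain ⟨y, hy, hy'⟩ := exists_preimage_norm_le_of_isSelfAdjoint f (imaginaryPart a).2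
  refine ⟨x + Complex.I • y, ?_, ?_⟩
  · rw [map_add, map_smul, hx, hy, ← map_smul, ← map_add, realPart_add_I_smul_imaginaryPart]
  · refine (norm_add_le _ _).trans ?_
    rw [norm_smul, Complex.norm_I, one_mul, two_mul]
    rw [hre] at hx'
    rw [him] at hy'
    exact add_le_add (hx'.trans (realPart.norm_le (f a))) (hy'.trans (imaginaryPart.norm_le (f a)))

/-- A *-homomorphism of C*-algebras with dense range is surjective. -/
theorem surjective_of_denseRange (f : A →⋆ₐ[ℂ] B) (hf : DenseRange f) :
    Function.Surjective f := by
  let g : NormedAddGroupHom A B := (f : A →+ B).mkNormedAddGroupHom 1 fun a => by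
    rw [one_mul]
    exact NonUnitalStarAlgHom.norm_apply_le f a
  have hyp : g.SurjectiveOnWith (f : A →+ B).range 2 := by
    rintro _ ⟨a, rfl⟩
    exact exists_preimage_norm_le f a
  intro b
  -- Successive approximation: bounded lifts over the range extend to its closure, which is all of
  -- B.
  obtain ⟨a, ha, -⟩ := controlled_closure_of_complete two_pos one_pos hyp b (hf b)
  exact ⟨a, ha⟩

end Surjective

/-! ### Elementary tensors in the minimal tensor product -/

namespace MinTensor

variable {A B : Type u} [CStarAlgebra A] [CStarAlgebra B]

theorem tmul_eq_inclHom (a : A) (b : B) : tmul a b = (minFamily A B).inclHom (a ⊗ₜ[ℂ] b) := rfl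

theorem tmul_mul_tmul (a a' : A) (b b' : B) :
    tmul a b * tmul a' b' = tmul (a * a') (b * b') := by
  simp only [tmul_eq_inclHom, ← map_mul, Algebra.TensorProduct.tmul_mul_tmul]

theorem one_tmul_one : tmul (1 : A) (1 : B) = 1 :=
  map_one (minFamily A B).inclHom

theorem star_tmul (a : A) (b : B) : star (tmul a b) = tmul (star a) (star b) := by
  simp only [tmul_eq_inclHom, ← map_star, TensorProduct.star_tmul]

variable (A B) in
/-- The elementary tensor as a bilinear map. -/
def mkBilin : A →ₗ[ℂ] B →ₗ[ℂ] MinTensor A B :=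
  (TensorProduct.mk ℂ A B).compr₂ (minFamily A B).inclHom.toAlgHom.toLinearMap

theorem mkBilin_apply (a : A) (b : B) : mkBilin A B a b = tmul a b := rfl

theorem sum_tmul {ι : Type*} (s : Finset ι) (f : ι → A) (b : B) :
    tmul (∑ i ∈ s, f i) b = ∑ i ∈ s, tmul (f i) b := by
  simp only [← mkBilin_apply, map_sum, LinearMap.sum_apply]

theorem tmul_sum {ι : Type*} (s : Finset ι) (a : A) (f : ι → B) :
    tmul a (∑ i ∈ s, f i) = ∑ i ∈ s, tmul a (f i) := by
  simp only [← mkBilin_apply, map_sum]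

theorem zero_tmul (b : B) : tmul (0 : A) b = 0 := by
  rw [← mkBilin_apply, map_zero, LinearMap.zero_apply]

theorem tmul_zero (a : A) : tmul a (0 : B) = 0 := by
  rw [← mkBilin_apply, map_zero]

/-- In representations with aξ ≠ 0 and bη ≠ 0, the vector aξ ⊗ bη has squared norm ‖aξ‖² ‖bη‖². -/
theorem tmul_ne_zero {a : A} {b : B} (ha : a ≠ 0) (hb : b ≠ 0) : tmul a b ≠ 0 := by
  obtain ⟨π, ξ, hξ⟩ := exists_hilbRep_ne_zero ha
  obtain ⟨ρ, η, hη⟩ := exists_hilbRep_ne_zero hb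
  intro h
  have h1 := HilbRep.minTensor_hom_tmul π ρ a b ξ η
  rw [h, map_zero, zero_apply] at h1
  have h2 := HilbRep.inner_vec π ρ (π.hom a ξ) (π.hom a ξ) (ρ.hom b η) (ρ.hom b η)
  rw [← h1, inner_zero_left, eq_comm, mul_eq_zero, inner_self_eq_zero, inner_self_eq_zero] at h2
  exact h2.elim hξ hη

variable (A B) in
/-- `a ↦ a ⊗ 1`. -/
def inl : A →⋆ₐ[ℂ] MinTensor A B where
  toFun a := tmul a 1
  map_one' := one_tmul_one
  map_mul' a a' := by rw [tmul_mul_tmul, one_mul]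
  map_zero' := zero_tmul 1
  map_add' a a' := by simp only [← mkBilin_apply, map_add, LinearMap.add_apply]
  commutes' c := by
    rw [Algebra.algebraMap_eq_smul_one, Algebra.algebraMap_eq_smul_one, ← mkBilin_apply, map_smul,
      LinearMap.smul_apply, mkBilin_apply, one_tmul_one]
  map_star' a := by rw [star_tmul, star_one]

variable (A B) in
/-- `b ↦ 1 ⊗ b`. -/
def inr : B →⋆ₐ[ℂ] MinTensor A B where
  toFun b := tmul 1 b
  map_one' := one_tmul_one
  map_mul' b b' := by rw [tmul_mul_tmul, one_mul]
  map_zero' := tmul_zero 1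
  map_add' b b' := by simp only [← mkBilin_apply, map_add]
  commutes' c := by
    rw [Algebra.algebraMap_eq_smul_one, Algebra.algebraMap_eq_smul_one, ← mkBilin_apply, map_smul,
      mkBilin_apply, one_tmul_one]
  map_star' b := by rw [star_tmul, star_one]

theorem inl_apply (a : A) : inl A B a = tmul a 1 := rfl

theorem inr_apply (b : B) : inr A B b = tmul 1 b := rfl

theorem inl_mul_inr (a : A) (b : B) : inl A B a * inr A B b = tmul a b := by
  rw [inl_apply, inr_apply, tmul_mul_tmul, one_mul, mul_one]

theorem inr_mul_inl (a : A) (b : B) : inr A B b * inl A B a = tmul a b := by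
  rw [inl_apply, inr_apply, tmul_mul_tmul, one_mul, mul_one]

theorem dense_span_tmul :
    Dense (Submodule.span ℂ {z : MinTensor A B | ∃ a b, z = tmul a b} : Set (MinTensor A B)) := by
  refine (minFamily A B).denseRange_incl.mono ?_
  rintro _ ⟨x, rfl⟩
  induction x with
  | zero => exact Submodule.zero_mem _
  | add x y hx hy => rw [RepFamily.incl_add]; exact Submodule.add_mem _ hx hy
  | tmul a b => exact Submodule.subset_span ⟨a, b, rfl⟩

end MinTensor

/-! ### Universal properties of the free *-algebra and of algebras generated by projections -/

namespace FreeStar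

variable {X : Type u} {B : Type*} [Ring B] [Algebra ℂ B]

/-- The homomorphism that takes given values on the generators. -/
def liftAlgHom (f : X → B) : FreeStar X →ₐ[ℂ] B := FreeAlgebra.lift ℂ f

theorem liftAlgHom_gen (f : X → B) (x : X) : liftAlgHom f (gen x) = f x :=
  FreeAlgebra.lift_ι_apply f x

variable [StarRing B] [StarModule ℂ B]

/-- The *-homomorphism that takes given self-adjoint values on the generators. -/
def lift (f : X → B) (hf : ∀ x, IsSelfAdjoint (f x)) : FreeStar X →⋆ₐ[ℂ] B :=
  { liftAlgHom f with
    map_star' := fun z => by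
      change liftAlgHom f (star z) = star (liftAlgHom f z)
      refine induct z (fun c => ?_) (fun x => ?_) (fun x y hx hy => ?_) fun x y hx hy => ?_
      · rw [← algebraMap_star_comm, AlgHom.commutes, AlgHom.commutes, algebraMap_star_comm]
      · rw [star_gen, liftAlgHom_gen, (hf x).star_eq]
      · rw [star_mul, map_mul, map_mul, star_mul, hx, hy]
      · rw [star_add, map_add, map_add, star_add, hx, hy] }

theorem lift_gen (f : X → B) (hf : ∀ x, IsSelfAdjoint (f x)) (x : X) : lift f hf (gen x) = f x :=
  liftAlgHom_gen f x

end FreeStar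

namespace ProjCStar

variable {X : Type u} {R : Set (FreeStar X)}

theorem inclHom_gen (x : X) : (projFamily X R).inclHom (FreeStar.gen x) = gen R x := rfl

/-- Every representation of the family kills r, so its seminorm is zero and it dies in the Hausdorff
completion. -/
theorem inclHom_relation {r : FreeStar X} (hr : r ∈ R) : (projFamily X R).inclHom r = 0 := by
  refine norm_le_zero_iff.1 (((projFamily X R).norm_incl r).le.trans ?_)
  exact RepFamily.seminorm_le _ le_rfl fun π hπ => by rw [hπ.2 r hr, norm_zero]

theorem isStarProjection_gen (x : X) : IsStarProjection (gen R x) where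
  isSelfAdjoint := by
    change star (gen R x) = _
    rw [← inclHom_gen, ← map_star, FreeStar.star_gen]
  isIdempotentElem := by
    change gen R x * gen R x = gen R x
    rw [← inclHom_gen, ← map_mul, ← sub_eq_zero, ← map_sub]
    refine norm_le_zero_iff.1 (((projFamily X R).norm_incl _).le.trans ?_)
    refine RepFamily.seminorm_le _ le_rfl fun π hπ => ?_
    rw [map_sub, map_mul, (hπ.1 x).eq, sub_self, norm_zero]

variable {B : Type u} [CStarAlgebra B]

/-- The universal property: projections satisfying the relations define a *-homomorphism. -/
def lift (f : X → B) (hf : ∀ x, IsStarProjection (f x))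
    (hR : ∀ r ∈ R, FreeStar.lift f (fun x => (hf x).isSelfAdjoint) r = 0) :
    ProjCStar X R →⋆ₐ[ℂ] B :=
  (projFamily X R).lift (FreeStar.lift f fun x => (hf x).isSelfAdjoint) fun z =>
    -- Each representation of B, pulled back along the map of generators, belongs to the family
    -- defining the seminorm.
    norm_le_of_forall_hilbRep (RepFamily.seminorm_nonneg _ z) fun π =>
      (projFamily X R).le_seminorm
        ⟨π.space, π.hom.comp (FreeStar.lift f fun x => (hf x).isSelfAdjoint)⟩
        ⟨fun x => by
          change π.hom (FreeStar.lift f _ _) * π.hom (FreeStar.lift f _ _) =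
            π.hom (FreeStar.lift f _ _)
          rw [FreeStar.lift_gen, ← map_mul, (hf x).isIdempotentElem.eq],
        fun r hr => by
          change π.hom (FreeStar.lift f _ _) = 0
          rw [hR r hr, map_zero]⟩ z

theorem lift_gen (f : X → B) (hf : ∀ x, IsStarProjection (f x))
    (hR : ∀ r ∈ R, FreeStar.lift f (fun x => (hf x).isSelfAdjoint) r = 0) (x : X) :
    lift f hf hR (gen R x) = f x :=
  (RepFamily.lift_incl _ _ _ _).trans (FreeStar.lift_gen f _ x)

end ProjCStar

/-! ### Reduction of coassociativity and density to generators -/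

section Coassoc

variable {W A : Type u} [Fintype W] [CStarAlgebra A]

/-- Two representations that act in the same way on two families of vectors with the same inner
products have the same matrix entries on these families, if the generators preserve the spans. -/
theorem inner_eq_of_gen {X : Type u} {H K ι : Type*} [NormedAddCommGroup H]
    [InnerProductSpace ℂ H] [CompleteSpace H] [NormedAddCommGroup K] [InnerProductSpace ℂ K]
    [CompleteSpace K] (f : FreeStar X →⋆ₐ[ℂ] A) (hf : DenseRange f)
    (S : A →⋆ₐ[ℂ] (H →L[ℂ] H)) (T : A →⋆ₐ[ℂ] (K →L[ℂ] K)) (e : ι → H × K)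
    (he : ∀ s t, ⟪(e s).1, (e t).1⟫_ℂ = ⟪(e s).2, (e t).2⟫_ℂ)
    (hgen : ∀ x t, (S (f (FreeStar.gen x)) (e t).1, T (f (FreeStar.gen x)) (e t).2) ∈
      Submodule.span ℂ (Set.range e)) (a : A) (s t : ι) :
    ⟪(e s).1, S a (e t).1⟫_ℂ = ⟪(e s).2, T a (e t).2⟫_ℂ := by
  -- G is the graph of the would-be isometry (e s).1 ↦ (e s).2. Working with pairs avoids
  -- constructing this isometry: it is enough that G is invariant under (S, T) and that both
  -- coordinates have the same inner products with the given vectors.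
  let G := Submodule.span ℂ (Set.range e)
  have inner_eq : ∀ s, ∀ p ∈ G, ⟪(e s).1, p.1⟫_ℂ = ⟪(e s).2, p.2⟫_ℂ := by
    intro s p hp
    induction hp using Submodule.span_induction with
    | mem p hp =>
      obtain ⟨t, rfl⟩ := hp
      exact he s t
    | zero => simp
    | add p q _ _ h h' => simp only [Prod.fst_add, Prod.snd_add, inner_add_right, h, h']
    | smul c p _ h => simp only [Prod.smul_fst, Prod.smul_snd, inner_smul_right, h]
  have invariant : ∀ z : FreeStar X, ∀ p ∈ G, (S (f z) p.1, T (f z) p.2) ∈ G := by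
    intro z
    refine FreeStar.induct z (fun c p hp => ?_) (fun x p hp => ?_) (fun x y hx hy p hp => ?_)
      fun x y hx hy p hp => ?_
    · rw [AlgHomClass.commutes f, AlgHomClass.commutes S, AlgHomClass.commutes T,
        Algebra.algebraMap_eq_smul_one, Algebra.algebraMap_eq_smul_one]
      exact G.smul_mem c hp
    · induction hp using Submodule.span_induction with
      | mem p hp =>
        obtain ⟨t, rfl⟩ := hp
        exact hgen x t
      | zero =>
        simp only [Prod.fst_zero, Prod.snd_zero, map_zero]
        exact G.zero_mem
      | add p q _ _ hp hq =>
        simp only [Prod.fst_add, Prod.snd_add, map_add]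
        exact G.add_mem hp hq
      | smul c p _ hp =>
        simp only [Prod.smul_fst, Prod.smul_snd, map_smul]
        exact G.smul_mem c hp
    · rw [map_mul, map_mul, map_mul]
      exact hx _ (hy p hp)
    · rw [map_add, map_add, map_add]
      exact G.add_mem (hx p hp) (hy p hp)
  have cS : Continuous S := continuous_starAlgHom S
  have cT : Continuous T := continuous_starAlgHom T
  refine hf.induction_on a (isClosed_eq (by fun_prop) (by fun_prop)) fun z => ?_
  exact inner_eq s _ (invariant z _ (Submodule.subset_span ⟨t, rfl⟩))

/-- A comultiplication of matrix form on a set of generators is coassociative. -/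
theorem coassoc_of_denseRange (f : FreeStar (W × W) →⋆ₐ[ℂ] A) (hf : DenseRange f)
    (Δ : A →⋆ₐ[ℂ] MinTensor A A)
    (hΔ : ∀ x a, Δ (f (FreeStar.gen (x, a))) =
      ∑ r, MinTensor.tmul (f (FreeStar.gen (x, r))) (f (FreeStar.gen (r, a)))) (a : A) :
    MinTensor.AssocEq (MinTensor.map Δ (StarAlgHom.id ℂ A) (Δ a))
      (MinTensor.map (StarAlgHom.id ℂ A) Δ (Δ a)) := by
  intro π ρ σ ξ ξ' η η' ζ ζ'
  -- The pairs are the elementary tensors ξ ⊗ η ⊗ ζ in their two bracketings; on a generator both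
  -- iterated comultiplications act by the same double sum.
  refine inner_eq_of_gen f hf
    (((π.minTensor ρ).minTensor σ).hom.comp ((MinTensor.map Δ (StarAlgHom.id ℂ A)).comp Δ))
    ((π.minTensor (ρ.minTensor σ)).hom.comp ((MinTensor.map (StarAlgHom.id ℂ A) Δ).comp Δ))
    (fun t : π.space × ρ.space × σ.space => ((π.minTensor ρ).vec σ (π.vec ρ t.1 t.2.1) t.2.2,
      π.vec (ρ.minTensor σ) t.1 (ρ.vec σ t.2.1 t.2.2)))
    (fun s t => by simp only [HilbRep.inner_vec, mul_assoc]) ?_ a (ξ', η', ζ') (ξ, η, ζ)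
  rintro ⟨x, a⟩ ⟨ξ, η, ζ⟩
  have key₁ : MinTensor.map Δ (StarAlgHom.id ℂ A) (Δ (f (FreeStar.gen (x, a)))) =
      ∑ r, ∑ s, MinTensor.tmul (MinTensor.tmul (f (FreeStar.gen (x, s)))
        (f (FreeStar.gen (s, r)))) (f (FreeStar.gen (r, a))) := by
    simp only [hΔ, map_sum, MinTensor.map_tmul, MinTensor.sum_tmul, StarAlgHom.coe_id, id]
  have key₂ : MinTensor.map (StarAlgHom.id ℂ A) Δ (Δ (f (FreeStar.gen (x, a)))) =
      ∑ r, ∑ s, MinTensor.tmul (f (FreeStar.gen (x, s))) (MinTensor.tmul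
        (f (FreeStar.gen (s, r))) (f (FreeStar.gen (r, a)))) := by
    rw [Finset.sum_comm]
    simp only [hΔ, map_sum, MinTensor.map_tmul, MinTensor.tmul_sum, StarAlgHom.coe_id, id]
  simp only [StarAlgHom.comp_apply, key₁, key₂, map_sum, sum_apply, HilbRep.minTensor_hom_tmul]
  have mem := Submodule.sum_mem _ fun r (_ : r ∈ Finset.univ) =>
    Submodule.sum_mem _ fun s (_ : s ∈ Finset.univ) => Submodule.subset_span (R := ℂ)
      (Set.mem_range_self (f := fun t : π.space × ρ.space × σ.space =>
        ((π.minTensor ρ).vec σ (π.vec ρ t.1 t.2.1) t.2.2,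
          π.vec (ρ.minTensor σ) t.1 (ρ.vec σ t.2.1 t.2.2)))
        (π.hom (f (FreeStar.gen (x, s))) ξ, ρ.hom (f (FreeStar.gen (s, r))) η,
          σ.hom (f (FreeStar.gen (r, a))) ζ))
  convert mem using 1
  exact Prod.ext (by simp only [Prod.fst_sum]) (by simp only [Prod.snd_sum])

/-- If `i` and `j` are commuting homomorphisms, `i(X) j(A)` is total, and the span of `j(A) Δ(A)`
contains `i(x)` for the generators `x`, then `j(A) Δ(A)` is total. -/
theorem dense_span_mul_of_gen {X : Type u} {M : Type*} [CStarAlgebra M]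
    (f : FreeStar X →⋆ₐ[ℂ] A) (hf : DenseRange f) (i j Δ : A →⋆ₐ[ℂ] M)
    (hij : ∀ a b, i a * j b = j b * i a)
    (hdense : Dense (Submodule.span ℂ {z : M | ∃ a b, z = j b * i a} : Set M))
    (hgen : ∀ x, i (f (FreeStar.gen x)) ∈ Submodule.span ℂ {z : M | ∃ a b, z = j a * Δ b}) :
    Dense (Submodule.span ℂ {z : M | ∃ a b, z = j a * Δ b} : Set M) := by
  set D := Submodule.span ℂ {z : M | ∃ a b, z = j a * Δ b}
  have left_mem : ∀ a, ∀ y ∈ D, j a * y ∈ D := by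
    intro a y hy
    induction hy using Submodule.span_induction with
    | mem y hy =>
      obtain ⟨a', b, rfl⟩ := hy
      exact Submodule.subset_span ⟨a * a', b, by rw [map_mul, mul_assoc]⟩
    | zero => simp
    | add x y _ _ hx hy => rw [mul_add]; exact D.add_mem hx hy
    | smul c y _ hy => rw [mul_smul_comm]; exact D.smul_mem c hy
  have right_mem : ∀ b, ∀ y ∈ D, y * Δ b ∈ D := by
    intro b y hy
    induction hy using Submodule.span_induction with
    | mem y hy =>
      obtain ⟨a, b', rfl⟩ := hy
      exact Submodule.subset_span ⟨a, b' * b, by rw [map_mul, mul_assoc]⟩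
    | zero => simp
    | add x y _ _ hx hy => rw [add_mul]; exact D.add_mem hx hy
    | smul c y _ hy => rw [smul_mul_assoc]; exact D.smul_mem c hy
  -- Since i w commutes with j a, i w · j a Δ b = j a (i w) Δ b, and D is stable under j(A) on the
  -- left and Δ(A) on the right. Hence the w with i w ∈ D are closed under products, and generators
  -- suffice.
  have mul_mem : ∀ w, i w ∈ D → ∀ y ∈ D, i w * y ∈ D := by
    intro w hw y hy
    induction hy using Submodule.span_induction with
    | mem y hy =>
      obtain ⟨a, b, rfl⟩ := hy
      rw [← mul_assoc, hij, mul_assoc]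
      exact left_mem a _ (right_mem b _ hw)
    | zero => simp
    | add x y _ _ hx hy => rw [mul_add]; exact D.add_mem hx hy
    | smul c y _ hy => rw [mul_smul_comm]; exact D.smul_mem c hy
  have mem : ∀ z, i (f z) ∈ D := by
    intro z
    refine FreeStar.induct z (fun c => ?_) hgen (fun x y hx hy => ?_) fun x y hx hy => ?_
    · rw [AlgHomClass.commutes f, AlgHomClass.commutes i, Algebra.algebraMap_eq_smul_one]
      exact D.smul_mem c (Submodule.subset_span ⟨1, 1, by simp⟩)
    · rw [map_mul, map_mul]
      exact mul_mem _ hx _ hy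
    · rw [map_add, map_add]
      exact D.add_mem hx hy
  have ci : Continuous i := continuous_starAlgHom i
  have hle : Submodule.span ℂ {z : M | ∃ a b, z = j b * i a} ≤ D.topologicalClosure := by
    rw [Submodule.span_le]
    rintro _ ⟨a, b, rfl⟩
    refine hf.induction_on a (IsClosed.preimage (f := fun a => j b * i a) (by fun_prop)
      D.isClosed_topologicalClosure) fun z => ?_
    exact D.le_topologicalClosure (left_mem b _ (mem z))
  rw [Submodule.dense_iff_topologicalClosure_eq_top] at hdense ⊢
  rw [eq_top_iff, ← hdense]
  exact Submodule.topologicalClosure_minimal _ hle D.isClosed_topologicalClosure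

end Coassoc

/-! ### Magic unitaries and the orbital relation -/

theorem mul_eq_zero_comm_of_isStarProjection {A : Type*} [CStarAlgebra A] {p q : A}
    (hp : IsStarProjection p) (hq : IsStarProjection q) : p * q = 0 ↔ q * p = 0 := by
  rw [← star_eq_zero, star_mul, hp.isSelfAdjoint.star_eq, hq.isSelfAdjoint.star_eq]

theorem isStarProjection_sum {A ι : Type*} [CStarAlgebra A] {s : Finset ι} {p : ι → A}
    (hp : ∀ i ∈ s, IsStarProjection (p i)) (h : ∀ i ∈ s, ∀ j ∈ s, i ≠ j → p i * p j = 0) :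
    IsStarProjection (∑ i ∈ s, p i) where
  isIdempotentElem := by
    change (∑ i ∈ s, p i) * ∑ i ∈ s, p i = _
    rw [Finset.sum_mul]
    refine Finset.sum_congr rfl fun i hi => ?_
    rw [Finset.mul_sum, Finset.sum_eq_single_of_mem i hi fun j hj hji => h i hi j hj hji.symm,
      (hp i hi).isIdempotentElem.eq]
  isSelfAdjoint := by
    change star _ = _
    rw [star_sum]
    exact Finset.sum_congr rfl fun i hi => (hp i hi).isSelfAdjoint.star_eq

/-- A magic unitary: a matrix of projections whose rows and columns sum to `1`. -/
structure IsMagicUnitary {W A : Type u} [Fintype W] [CStarAlgebra A] (u : W → W → A) : Prop where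
  proj : ∀ i j, IsStarProjection (u i j)
  row_sum : ∀ i, ∑ j, u i j = 1
  col_sum : ∀ j, ∑ i, u i j = 1

namespace IsMagicUnitary

variable {W A : Type u} [Fintype W] [CStarAlgebra A] {u : W → W → A}

theorem row_orthogonal (hu : IsMagicUnitary u) (i : W) {j k : W} (h : j ≠ k) :
    u i j * u i k = 0 :=
  mul_eq_zero_of_sum_eq_one (hu.proj i) (hu.row_sum i) h

theorem col_orthogonal (hu : IsMagicUnitary u) (j : W) {i k : W} (h : i ≠ k) :
    u i j * u k j = 0 :=
  mul_eq_zero_of_sum_eq_one (p := fun i => u i j) (fun i => hu.proj i j) (hu.col_sum j) h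

theorem map (hu : IsMagicUnitary u) {B : Type u} [CStarAlgebra B] (f : A →⋆ₐ[ℂ] B) :
    IsMagicUnitary fun i j => f (u i j) where
  proj i j := (hu.proj i j).map f
  row_sum i := by rw [← map_sum, hu.row_sum, map_one]
  col_sum j := by rw [← map_sum, hu.col_sum, map_one]

/-- With `sum_conj_col`, this makes u_{p1,q1} u_{p2,q2} u_{p1,q1} a doubly stochastic matrix of
positive elements indexed by p and q; an entry vanishes exactly when p and q are unrelated. -/
theorem sum_conj_row (hu : IsMagicUnitary u) (p : W × W) :
    ∑ q : W × W, u p.1 q.1 * u p.2 q.2 * u p.1 q.1 = 1 := by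
  simp only [Fintype.sum_prod_type, ← Finset.sum_mul, ← Finset.mul_sum, hu.row_sum, mul_one,
    (hu.proj _ _).isIdempotentElem.eq]

theorem sum_conj_col (hu : IsMagicUnitary u) (q : W × W) :
    ∑ p : W × W, u p.1 q.1 * u p.2 q.2 * u p.1 q.1 = 1 := by
  simp only [Fintype.sum_prod_type, ← Finset.sum_mul, ← Finset.mul_sum, hu.col_sum, mul_one,
    (hu.proj _ _).isIdempotentElem.eq]

theorem conj_eq_zero {W A : Type u} [CStarAlgebra A] {u : W → W → A} {p q : W × W} (h : ¬ OrbitalRel u p q) :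
    u p.1 q.1 * u p.2 q.2 * u p.1 q.1 = 0 := by
  rw [not_not.1 h, zero_mul]

theorem exists_orbitalRel [Nontrivial A] (hu : IsMagicUnitary u) (p : W × W) :
    ∃ q, OrbitalRel u p q := by
  by_contra! h
  have := hu.sum_conj_row p
  rw [Finset.sum_eq_zero fun q _ => conj_eq_zero (h q)] at this
  exact zero_ne_one this

/-- A set that is closed under successors of the orbital relation is closed under predecessors. -/
theorem mem_of_orbitalRel (hu : IsMagicUnitary u) {N : Set (W × W)}
    (hN : ∀ p q, p ∈ N → OrbitalRel u p q → q ∈ N) {p q : W × W} (hq : q ∈ N)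
    (hpq : OrbitalRel u p q) : p ∈ N := by
  classical
  set a : W × W → W × W → A := fun p q => u p.1 q.1 * u p.2 q.2 * u p.1 q.1 with ha
  set S := N.toFinset
  have mem_S : ∀ r, r ∈ S ↔ r ∈ N := fun r => Set.mem_toFinset
  have h1 : ∑ r ∈ S, ∑ s ∈ S, a r s = S.card • (1 : A) := by
    rw [← Finset.sum_const]
    refine Finset.sum_congr rfl fun r hr => ?_
    rw [← hu.sum_conj_row r]
    refine Finset.sum_subset (Finset.subset_univ _) fun s _ hs => conj_eq_zero fun hrs => ?_
    exact hs ((mem_S s).2 (hN r s ((mem_S r).1 hr) hrs))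
  have h2 : ∑ s ∈ S, ∑ r, a r s = S.card • (1 : A) := by
    rw [← Finset.sum_const]
    exact Finset.sum_congr rfl fun s _ => hu.sum_conj_col s
  -- Double counting: the rows in S are supported in S, so the block S × S already sums to |S|; the
  -- columns in S also sum to |S| in total, leaving nothing for the block Sᶜ × S.
  have h3 : ∑ t ∈ Sᶜ ×ˢ S, a t.1 t.2 = 0 := by
    rw [Finset.sum_product, ← add_eq_left (a := S.card • (1 : A)), ← h1,
      Finset.sum_add_sum_compl, Finset.sum_comm, h2, h1]
  have h4 := eq_zero_of_sum_conj_eq_zero (s := Sᶜ ×ˢ S) (p := fun t => u t.1.1 t.2.1)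
    (q := fun t => u t.1.2 t.2.2) (fun t _ => hu.proj _ _) (fun t _ => hu.proj _ _) h3
  by_contra hp
  refine hpq ((mul_eq_zero_comm_of_isStarProjection (hu.proj _ _) (hu.proj _ _)).2
    (h4 (p, q) (Finset.mem_product.2 ⟨?_, (mem_S q).2 hq⟩)))
  rwa [Finset.mem_compl, mem_S]

/-- A transitive orbital relation is an equivalence relation. -/
theorem equivalence_orbitalRel [Nontrivial A] (hu : IsMagicUnitary u)
    (htrans : ∀ p q r, OrbitalRel u p q → OrbitalRel u q r → OrbitalRel u p r) :
    Equivalence (OrbitalRel u) := by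
  have refl : ∀ p, OrbitalRel u p p := fun p => by
    obtain ⟨q, hq⟩ := hu.exists_orbitalRel p
    -- The successors of p form a set closed under successors; p precedes one of its members q, so p
    -- itself belongs to it.
    exact hu.mem_of_orbitalRel (N := {q | OrbitalRel u p q}) (fun q r => htrans p q r) hq hq
  refine ⟨refl, fun {p q} hpq => ?_, fun {p q r} => htrans p q r⟩
  -- The successors of q include q by reflexivity, hence also its predecessor p.
  exact hu.mem_of_orbitalRel (N := {r | OrbitalRel u q r}) (fun r s => htrans q r s) (refl q) hpq

theorem isPartition_quantumOrbitals [Nontrivial A] (hu : IsMagicUnitary u)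
    (htrans : ∀ p q r, OrbitalRel u p q → OrbitalRel u q r → OrbitalRel u p r) :
    Setoid.IsPartition (quantumOrbitals u) := by
  have he := hu.equivalence_orbitalRel htrans
  let S : Setoid (W × W) := ⟨OrbitalRel u, he⟩
  convert Setoid.isPartition_classes S using 1
  ext O
  refine exists_congr fun p => ?_
  have : {q | OrbitalRel u p q} = {q | S q p} := Set.ext fun q => ⟨he.symm, he.symm⟩
  rw [this]

/-! ### Comultiplication of matrix form on a magic unitary -/

section Comul

variable {Δ : A →⋆ₐ[ℂ] MinTensor A A}

/-- Orthogonality in row i kills every summand but the k-th. The mirror image `comul_mul_inl` is its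
adjoint. -/
theorem inl_mul_comul (hu : IsMagicUnitary u)
    (hΔ : ∀ i j, Δ (u i j) = ∑ k, MinTensor.tmul (u i k) (u k j)) (i j k : W) :
    MinTensor.inl A A (u i k) * Δ (u i j) = MinTensor.tmul (u i k) (u k j) := by
  rw [hΔ, Finset.mul_sum, Finset.sum_eq_single k]
  · rw [MinTensor.inl_apply, MinTensor.tmul_mul_tmul, (hu.proj i k).isIdempotentElem.eq, one_mul]
  · intro l _ hl
    rw [MinTensor.inl_apply, MinTensor.tmul_mul_tmul, hu.row_orthogonal i hl.symm,
      MinTensor.zero_tmul]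
  · simp

theorem comul_mul_inl (hu : IsMagicUnitary u)
    (hΔ : ∀ i j, Δ (u i j) = ∑ k, MinTensor.tmul (u i k) (u k j)) (i j k : W) :
    Δ (u i j) * MinTensor.inl A A (u i k) = MinTensor.tmul (u i k) (u k j) := by
  have := congrArg star (hu.inl_mul_comul hΔ i j k)
  rwa [star_mul, ← map_star, ← map_star, MinTensor.star_tmul, (hu.proj _ _).isSelfAdjoint.star_eq,
    (hu.proj _ _).isSelfAdjoint.star_eq, (hu.proj _ _).isSelfAdjoint.star_eq] at this

/-- Here the second leg selects the summand, by orthogonality in column j. -/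
theorem inr_mul_comul (hu : IsMagicUnitary u)
    (hΔ : ∀ i j, Δ (u i j) = ∑ k, MinTensor.tmul (u i k) (u k j)) (i j k : W) :
    MinTensor.inr A A (u k j) * Δ (u i j) = MinTensor.tmul (u i k) (u k j) := by
  rw [hΔ, Finset.mul_sum, Finset.sum_eq_single k]
  · rw [MinTensor.inr_apply, MinTensor.tmul_mul_tmul, (hu.proj k j).isIdempotentElem.eq, one_mul]
  · intro l _ hl
    rw [MinTensor.inr_apply, MinTensor.tmul_mul_tmul, hu.col_orthogonal j hl.symm,
      MinTensor.tmul_zero]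
  · simp

/-- Cutting Δ(u_{p1,r1} u_{p2,r2}) by u_{p1,q1} ⊗ 1 on the left and u_{p2,q2} ⊗ 1 on the right
leaves a single elementary tensor with both legs nonzero. -/
theorem orbitalRel_trans (hu : IsMagicUnitary u)
    (hΔ : ∀ i j, Δ (u i j) = ∑ k, MinTensor.tmul (u i k) (u k j)) (p q r : W × W)
    (hpq : OrbitalRel u p q) (hqr : OrbitalRel u q r) : OrbitalRel u p r := by
  intro h
  refine MinTensor.tmul_ne_zero hpq hqr ?_
  rw [← MinTensor.tmul_mul_tmul, ← hu.inl_mul_comul hΔ, ← hu.comul_mul_inl hΔ, mul_assoc,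
    ← mul_assoc (Δ _), ← map_mul Δ, h, map_zero, zero_mul, mul_zero]

/-- The matrix `∑ k, u i k ⊗ u k j` is a magic unitary. -/
theorem comul (hu : IsMagicUnitary u) :
    IsMagicUnitary fun i j => ∑ k, MinTensor.tmul (u i k) (u k j) where
  proj i j := isStarProjection_sum
    (fun k _ =>
      { isIdempotentElem := by
          change _ * _ = _
          rw [MinTensor.tmul_mul_tmul, (hu.proj i k).isIdempotentElem.eq,
            (hu.proj k j).isIdempotentElem.eq]
        isSelfAdjoint := by
          change star _ = _
          rw [MinTensor.star_tmul, (hu.proj i k).isSelfAdjoint.star_eq,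
            (hu.proj k j).isSelfAdjoint.star_eq] })
    fun k _ l _ hkl => by
      rw [MinTensor.tmul_mul_tmul, hu.row_orthogonal i hkl, MinTensor.zero_tmul]
  row_sum i := by
    rw [Finset.sum_comm]
    simp only [← MinTensor.tmul_sum, hu.row_sum, ← MinTensor.sum_tmul, MinTensor.one_tmul_one]
  col_sum j := by
    rw [Finset.sum_comm]
    simp only [← MinTensor.sum_tmul, hu.col_sum, ← MinTensor.tmul_sum, MinTensor.one_tmul_one]

/-- A C*-algebra generated by a magic unitary, with the comultiplication of matrix form, is a compact
quantum group. -/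
theorem isCompactQuantumGroup (hu : IsMagicUnitary u)
    (hΔ : ∀ i j, Δ (u i j) = ∑ k, MinTensor.tmul (u i k) (u k j))
    (f : FreeStar (W × W) →⋆ₐ[ℂ] A) (hf : DenseRange f)
    (hfu : ∀ i j, f (FreeStar.gen (i, j)) = u i j) : IsCompactQuantumGroup Δ where
  coassoc := coassoc_of_denseRange f hf Δ fun i j => by simp only [hfu, hΔ]
  dense_right := by
    refine dense_span_mul_of_gen f hf (MinTensor.inl A A) (MinTensor.inr A A) Δ
      (fun a b => by rw [MinTensor.inl_mul_inr, MinTensor.inr_mul_inl]) ?_ ?_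
    · simp only [MinTensor.inr_mul_inl]
      exact MinTensor.dense_span_tmul
    · rintro ⟨i, k⟩
      -- The summands are u_{ik} ⊗ u_{kj}, and row k sums to 1. The factor u_{kj} plays the role of
      -- the antipode of u_{jk}.
      have : MinTensor.inl A A (u i k) =
          ∑ j, MinTensor.inr A A (u k j) * Δ (u i j) := by
        simp only [hu.inr_mul_comul hΔ, ← MinTensor.tmul_sum, hu.row_sum, MinTensor.inl_apply]
      rw [hfu, this]
      exact Submodule.sum_mem _ fun j _ => Submodule.subset_span ⟨_, _, rfl⟩
  dense_left := by
    refine dense_span_mul_of_gen f hf (MinTensor.inr A A) (MinTensor.inl A A) Δ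
      (fun a b => by rw [MinTensor.inl_mul_inr, MinTensor.inr_mul_inl]) ?_ ?_
    · simp only [MinTensor.inl_mul_inr]
      convert MinTensor.dense_span_tmul (A := A) (B := A) using 5
      exact exists_comm
    · rintro ⟨k, j⟩
      -- The mirror identity: the summands are again u_{ik} ⊗ u_{kj}, and now column k sums to 1.
      have : MinTensor.inr A A (u k j) =
          ∑ i, MinTensor.inl A A (u i k) * Δ (u i j) := by
        simp only [hu.inl_mul_comul hΔ, ← MinTensor.sum_tmul, hu.col_sum, MinTensor.inr_apply]
      rw [hfu, this]
      exact Submodule.sum_mem _ fun j _ => Submodule.subset_span ⟨_, _, rfl⟩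

end Comul

end IsMagicUnitary

/-! ### The universal magic unitary -/

section SPlus

variable {W : Type u} [Fintype W] [DecidableEq W]

theorem row_relation (i j : W) :
    (genericMatrix W * (genericMatrix W).conjTranspose - 1) i j =
      ∑ k, FreeStar.gen (i, k) * FreeStar.gen (j, k) - (1 : Matrix W W (FreeStar (W × W))) i j := by
  simp [Matrix.mul_apply, genericMatrix, Matrix.conjTranspose_apply, FreeStar.star_gen]

theorem col_relation (i j : W) :
    ((genericMatrix W).conjTranspose * genericMatrix W - 1) i j =
      ∑ k, FreeStar.gen (k, i) * FreeStar.gen (k, j) - (1 : Matrix W W (FreeStar (W × W))) i j := by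
  simp [Matrix.mul_apply, genericMatrix, Matrix.conjTranspose_apply, FreeStar.star_gen]

/-- Only the diagonal entries of UU* = 1 and U*U = 1 are needed: there the products are squares of
projections, so they collapse to row and column sums. -/
theorem SPlus.isMagicUnitary_gen : IsMagicUnitary (SPlus.gen (W := W)) where
  proj i j := ProjCStar.isStarProjection_gen (i, j)
  row_sum i := by
    have h := ProjCStar.inclHom_relation (R := magicRelations W) (Or.inl ⟨i, i, rfl⟩)
    simp only [row_relation, map_sub, map_sum, map_mul, ProjCStar.inclHom_gen,
      (ProjCStar.isStarProjection_gen _).isIdempotentElem.eq, Matrix.one_apply_eq, map_one,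
      sub_eq_zero] at h
    exact h
  col_sum i := by
    have h := ProjCStar.inclHom_relation (R := magicRelations W) (Or.inr ⟨i, i, rfl⟩)
    simp only [col_relation, map_sub, map_sum, map_mul, ProjCStar.inclHom_gen,
      (ProjCStar.isStarProjection_gen _).isIdempotentElem.eq, Matrix.one_apply_eq, map_one,
      sub_eq_zero] at h
    exact h

variable {A : Type u} [CStarAlgebra A] {u : W → W → A}

/-- The *-homomorphism from the universal algebra defined by a magic unitary. -/
def IsMagicUnitary.lift (hu : IsMagicUnitary u) : SPlus W →⋆ₐ[ℂ] A :=
  ProjCStar.lift (fun x => u x.1 x.2) (fun x => hu.proj x.1 x.2) <| by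
    rintro _ (⟨i, j, rfl⟩ | ⟨i, j, rfl⟩)
    · rw [row_relation, map_sub, map_sum, sub_eq_zero]
      simp only [map_mul, FreeStar.lift_gen]
      rcases eq_or_ne i j with rfl | h
      · simp only [(hu.proj _ _).isIdempotentElem.eq, hu.row_sum, Matrix.one_apply_eq, map_one]
      · simp only [hu.col_orthogonal _ h, Finset.sum_const_zero, Matrix.one_apply_ne h, map_zero]
    · rw [col_relation, map_sub, map_sum, sub_eq_zero]
      simp only [map_mul, FreeStar.lift_gen]
      rcases eq_or_ne i j with rfl | h
      · simp only [(hu.proj _ _).isIdempotentElem.eq, hu.col_sum, Matrix.one_apply_eq, map_one]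
      · simp only [hu.row_orthogonal _ h, Finset.sum_const_zero, Matrix.one_apply_ne h, map_zero]

theorem IsMagicUnitary.lift_gen (hu : IsMagicUnitary u) (i j : W) :
    hu.lift (SPlus.gen i j) = u i j :=
  ProjCStar.lift_gen _ _ _ (i, j)

end SPlus

/-! ### The C*-algebra of a bisynchronous transitive game -/

namespace GameCStar

variable {W : Type u} [Fintype W] {V : W → W → W → W → Fin 2}

theorem gen_mul_gen_eq_zero {a b x y : W} (h : V a b x y = 0) : gen V x a * gen V y b = 0 := by
  have := ProjCStar.inclHom_relation (R := gameRelations V) (Or.inr ⟨a, b, x, y, h, rfl⟩)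
  rwa [map_mul] at this

theorem sum_gen (x : W) : ∑ a, gen V x a = 1 := by
  have := ProjCStar.inclHom_relation (R := gameRelations V) (Or.inl ⟨x, rfl⟩)
  rwa [map_sub, map_sum, map_one, sub_eq_zero] at this

/-- In a bisynchronous game the generators form a magic unitary. -/
theorem isMagicUnitary_gen (hV : IsBisynchronous V) : IsMagicUnitary (gen V) where
  proj x a := ProjCStar.isStarProjection_gen (x, a)
  row_sum := sum_gen
  col_sum a := by
    -- Bisynchronicity makes each column sum a projection, so its defect from 1 is positive. As
    -- questions and answers are both indexed by W, the row sums force the defects to add up to 0,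
    -- and each one vanishes.
    have hproj : ∀ a ∈ Finset.univ, IsStarProjection (1 - ∑ x, gen V x a) := fun a _ =>
      (isStarProjection_sum (fun x _ => ProjCStar.isStarProjection_gen (x, a))
        fun x _ y _ hxy => gen_mul_gen_eq_zero (hV.2 a x y hxy)).one_sub
    have hsum : ∑ a, (1 - ∑ x, gen V x a) = 0 := by
      rw [Finset.sum_sub_distrib, Finset.sum_comm, sub_eq_zero]
      exact Finset.sum_congr rfl fun x _ => (sum_gen x).symm
    exact (sub_eq_zero.1 (eq_zero_of_isStarProjection_sum hproj hsum a (Finset.mem_univ a))).symm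

variable {B : Type u} [CStarAlgebra B]

/-- The universal property of the C*-algebra of a game. -/
def lift (f : W → W → B) (hf : ∀ x a, IsStarProjection (f x a)) (hsum : ∀ x, ∑ a, f x a = 1)
    (hzero : ∀ a b x y, V a b x y = 0 → f x a * f y b = 0) : GameCStar V →⋆ₐ[ℂ] B :=
  ProjCStar.lift (fun x => f x.1 x.2) (fun x => hf x.1 x.2) <| by
    rintro _ (⟨x, rfl⟩ | ⟨a, b, x, y, h, rfl⟩)
    · simp only [map_sub, map_sum, FreeStar.lift_gen, hsum, map_one, sub_self]
    · rw [map_mul, FreeStar.lift_gen, FreeStar.lift_gen, hzero a b x y h]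

theorem lift_gen (f : W → W → B) (hf : ∀ x a, IsStarProjection (f x a))
    (hsum : ∀ x, ∑ a, f x a = 1) (hzero : ∀ a b x y, V a b x y = 0 → f x a * f y b = 0) (x a : W) :
    lift f hf hsum hzero (gen V x a) = f x a :=
  ProjCStar.lift_gen _ _ _ (x, a)

/-- The comultiplication on the C*-algebra of a bisynchronous transitive game. -/
def comul (hV : IsBisynchronous V) (ht : IsTransitive V) :
    GameCStar V →⋆ₐ[ℂ] MinTensor (GameCStar V) (GameCStar V) :=
  lift (fun x a => ∑ r, MinTensor.tmul (gen V x r) (gen V r a))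
    (isMagicUnitary_gen hV).comul.proj (isMagicUnitary_gen hV).comul.row_sum <| by
    intro a b x y h
    rw [Finset.sum_mul_sum]
    refine Finset.sum_eq_zero fun r _ => Finset.sum_eq_zero fun s _ => ?_
    rw [MinTensor.tmul_mul_tmul]
    -- Were both V(r,s|x,y) and V(a,b|r,s) equal to 1, transitivity would give V(a,b|x,y) = 1. So in
    -- every summand one of the two legs is zero.
    by_cases h₁ : V r s x y = 0
    · rw [gen_mul_gen_eq_zero h₁, MinTensor.zero_tmul]
    · by_cases h₂ : V a b r s = 0
      · rw [gen_mul_gen_eq_zero h₂, MinTensor.tmul_zero]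
      · have := ht a b x y ⟨r, s, Fin.eq_one_of_ne_zero _ h₂, Fin.eq_one_of_ne_zero _ h₁⟩
        rw [h] at this
        exact absurd this zero_ne_one

theorem comul_gen (hV : IsBisynchronous V) (ht : IsTransitive V) (x a : W) :
    comul hV ht (gen V x a) = ∑ r, MinTensor.tmul (gen V x r) (gen V r a) :=
  lift_gen _ _ _ _ x a

/-- The C*-algebra of a bisynchronous transitive game is a quantum permutation group. -/
theorem isQuantumPermutationGroup [DecidableEq W] (hV : IsBisynchronous V) (ht : IsTransitive V) :
    IsQuantumPermutationGroup (comul hV ht) (isMagicUnitary_gen hV).lift where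
  isCompactQuantumGroup := (isMagicUnitary_gen hV).isCompactQuantumGroup (comul_gen hV ht)
    (projFamily _ (gameRelations V)).inclHom (projFamily _ (gameRelations V)).denseRange_incl
    fun _ _ => rfl
  surjective := by
    -- The range contains all polynomials in the generators, which are dense.
    refine surjective_of_denseRange _
      ((projFamily _ (gameRelations V)).denseRange_incl.mono ?_)
    rintro _ ⟨z, rfl⟩
    change (projFamily _ (gameRelations V)).inclHom z ∈ _
    refine FreeStar.induct z (fun c => ⟨algebraMap ℂ _ c, ?_⟩) (fun x => ⟨SPlus.gen x.1 x.2, ?_⟩)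
      ?_ ?_
    · rw [AlgHomClass.commutes, AlgHomClass.commutes]
    · exact IsMagicUnitary.lift_gen _ _ _
    · rintro x y ⟨x', hx⟩ ⟨y', hy⟩
      exact ⟨x' * y', by rw [map_mul, map_mul, hx, hy]⟩
    · rintro x y ⟨x', hx⟩ ⟨y', hy⟩
      exact ⟨x' + y', by rw [map_add, map_add, hx, hy]⟩
  comul i j := by simp only [IsMagicUnitary.lift_gen, comul_gen]

end GameCStar

end QPG

end

/-! ### The game of a quantum permutation group -/

theorem mainTheorem2 {W : Type u} [Fintype W] [DecidableEq W] [Nonempty W]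
    {A : Type u} [CStarAlgebra A] [Nontrivial A]
    (Δ : A →⋆ₐ[ℂ] MinTensor A A) (π : SPlus W →⋆ₐ[ℂ] A)
    (h : IsQuantumPermutationGroup Δ π) :
    ∃ V : W → W → W → W → Fin 2,
      (∀ a b x y, V a b x y = 0 ↔ π (SPlus.gen x a) * π (SPlus.gen y b) = 0) ∧
      IsBisynchronous V ∧ IsTransitive V ∧ HasPerfectCStarStrategy V ∧
      ∃ (Δ' : GameCStar V →⋆ₐ[ℂ] MinTensor (GameCStar V) (GameCStar V))
        (π' : SPlus W →⋆ₐ[ℂ] GameCStar V),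
        (∀ x a, π' (SPlus.gen x a) = GameCStar.gen V x a) ∧
        (∀ x a, Δ' (GameCStar.gen V x a) =
          ∑ r, MinTensor.tmul (GameCStar.gen V x r) (GameCStar.gen V r a)) ∧
        IsQuantumPermutationGroup Δ' π' ∧
        Setoid.IsPartition (quantumOrbitals fun x a => π (SPlus.gen x a)) ∧
        quantumOrbitals (fun x a => π' (SPlus.gen x a)) =
          quantumOrbitals (fun x a => π (SPlus.gen x a)) := by
  classical
  set u : W → W → A := fun x a => π (SPlus.gen x a) with hu_def
  have hu : IsMagicUnitary u := SPlus.isMagicUnitary_gen.map π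
  let V : W → W → W → W → Fin 2 := fun a b x y => if u x a * u y b = 0 then 0 else 1
  have hV : ∀ a b x y, V a b x y = 0 ↔ u x a * u y b = 0 := fun a b x y => by
    by_cases h0 : u x a * u y b = 0 <;> simp [V, h0]
  have hV1 : ∀ a b x y, V a b x y = 1 ↔ u x a * u y b ≠ 0 := fun a b x y => by
    by_cases h0 : u x a * u y b = 0 <;> simp [V, h0]
  have htrans := hu.orbitalRel_trans h.comul
  have hbi : IsBisynchronous V := ⟨fun x a b hab => (hV _ _ _ _).2 (hu.row_orthogonal x hab),
    fun a x y hxy => (hV _ _ _ _).2 (hu.col_orthogonal a hxy)⟩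
  have ht : IsTransitive V := by
    rintro a b x y ⟨r, s, h1, h2⟩
    exact (hV1 _ _ _ _).2 (htrans (x, y) (r, s) (a, b) ((hV1 _ _ _ _).1 h2) ((hV1 _ _ _ _).1 h1))
  -- The given magic unitary satisfies the relations of its own game. As θ is unital with nonzero
  -- target, the game algebra is nonzero.
  let θ : GameCStar V →⋆ₐ[ℂ] A := GameCStar.lift u hu.proj hu.row_sum fun a b x y => (hV a b x y).1
  have hθ : ∀ x a, θ (GameCStar.gen V x a) = u x a := GameCStar.lift_gen _ _ _ _
  refine ⟨V, hV, hbi, ht, θ.toAlgHom.toRingHom.domain_nontrivial, GameCStar.comul hbi ht,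
    (GameCStar.isMagicUnitary_gen hbi).lift, IsMagicUnitary.lift_gen _, GameCStar.comul_gen hbi ht,
    GameCStar.isQuantumPermutationGroup hbi ht, hu.isPartition_quantumOrbitals htrans, ?_⟩
  -- A product that is zero in the game algebra is zero in A by θ; one that is zero in A is zero in
  -- the game algebra by definition of V.
  have hrel : ∀ p q, OrbitalRel (GameCStar.gen V) p q ↔ OrbitalRel u p q := fun p q => by
    refine not_congr ⟨fun h0 => ?_, fun h0 => GameCStar.gen_mul_gen_eq_zero ((hV _ _ _ _).2 h0)⟩
    rw [← hθ, ← hθ, ← map_mul, h0, map_zero]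
  simp only [IsMagicUnitary.lift_gen, quantumOrbitals, hrel]
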